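/- **Conventions.** For a link diagram $D$ with ordered crossings, a Kauffman state $s$ labels each crossing $A$ or $B$; smoothing each crossing according to its label gives a set $sD$ of circles (with a red scar at each $B$-labelled crossing and a blue one at each $A$-labelled crossing). An enhanced state is a Kauffman state with a sign $\pm$ on each circle of $sD$. Its homological degree $i$ is the number of $B$-labels, and its quantum degree is $j=i+\theta$, where $\theta$ is the number of $+$ circles minus the number of $-$ circles. Let $C^{i,j}(D)$ be the free $\mathbb{Z}$-module on the enhanced states of degrees $i,j$, with differential $d(S)=\sum_T i(S,T)\,T$. Here $i(S,T)=(-1)^k$ if $T$ is obtained from $S$ by changing one label, at a crossing $x$, from $A$ to $B$, with $j(T)=j(S)$ and with the same signs on the circles which do not touch $x$, $k$ being the number of $B$-labelled crossings of $S$ previous to $x$; otherwise $i(S,T)=0$. Let $\underline{Kh}(D)=\ker d/\operatorname{im} d=\bigoplus_{i,j}\underline{Kh}^{i,j}(D)$. Let $D=D(h_1,h_2)=P(-1,\overset{(h_1)}{\dots},-1,h_2)$ be the standard (monocircular) pretzel diagram. Smoothing all its crossings with label $A$ gives one circle and two ladders of parallel blue scars (steps): $H_1$, with $h_1$ steps (the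 crossings of the columns $-1$, from left to right), and $H_2$, with $h_2$ steps (the crossings of the column $h_2$, from top to bottom). The crossings are ordered with the steps of $H_1$ first and then those of $H_2$. For $0<m_i\le h_i$ and $r\in\{1,2\}$, let $s(m_1,m_2;C_r^{0-})$ be the sum, over all the choices of a set $M_1$ of $m_1$ steps of $H_1$ and a set $M_2$ of $m_2$ steps of $H_2$, of the enhanced state in which exactly the crossings in $M_1\cup M_2$ are labelled $B$ and all the circles have sign $+$, except for the circle $C_r^0$, which has sign $-$; here $C_r^0$ is the circle touching the first red scar of $M_r$ on the side preceding it in the ladder $H_r$. For integers $\mu_1,\mu_2$ put $$V(\mu_1,\mu_2)=\sum_{\substack{r\in\{1,2\}\\ \mu_r\text{ even},\ \mu_r<h_r}}(-1)^{\sum_{t<r}\mu_t}\,s(\mu_1+\delta_{1r},\mu_2+\delta_{2r};C_r^{0-})\qquad(\mu_1,\mu_2\ge 2),$$ where $\delta$ is the Kronecker delta, and, for $\mu\geq 1$ odd, $V(\mu,0)=(-1)^{\mu}s(\mu,1;C_1^{0-})$ and $V(0,\mu)=s(1,\mu;C_2^{0-})$. **Proposition 7.3.** Let $2\le\mu_1\le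 h_1$ and $2\le\mu_2\le h_2$ be integers such that $\mu_1$ is even with $\mu_1<h_1$, or $\mu_2$ is even with $\mu_2<h_2$. Then $V(\mu_1,\mu_2)$ is a cycle, and: 1. for every odd integer $\mu$ with $1\le\mu<h_1$, the chain $V(\mu,0)$ is a cycle and $[V(\mu_1,\mu_2)]\neq[V(\mu,0)]$ in $\underline{Kh}(D)$; 2. for every odd integer $\mu$ with $1\le\mu<h_2$, the chain $V(0,\mu)$ is a cycle and $[V(\mu_1,\mu_2)]\neq[V(0,\mu)]$ in $\underline{Kh}(D)$. -/

import Mathlib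

noncomputable section

namespace Khovanov

/-- The two possible labels of a crossing in a Kauffman state. -/
inductive Marker : Type
  | A : Marker
  | B : Marker

instance : Finite Marker :=
  Finite.of_injective (fun m : Marker => Marker.rec (motive := fun _ => Bool) true false m) (by
    intro a b h
    cases a <;> cases b <;> simp_all)

/-- A link diagram given by a planar diagram code. `X` is the set of crossings and `E` is the set
of edges of the underlying 4-valent graph. The four edge ends at a crossing `x` are
`corner x 0, corner x 1, corner x 2, corner x 3`, listed counterclockwise, where
`corner x 0` and `corner x 2` belong to the under-strand. Every edge has exactly two ends. -/
structure PDCode (X E : Type) where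
  corner : X → Fin 4 → E
  two_ends : ∀ e : E, {p : X × Fin 4 | corner p.1 p.2 = e}.ncard = 2

/-- A Kauffman state: a label for each crossing. -/
abbrev State (X : Type) : Type := X → Marker

namespace PDCode

variable {X E : Type} (D : PDCode X E)

/-- `D.Joined s e f`: at some crossing, the smoothing prescribed by `s` contains an arc
going from the edge `e` to the edge `f`. Rotating the over-strand counterclockwise sweeps the region
between corners `1` and `2` and the region between corners `3` and `0`; the `A`-smoothing merges
these two regions, so its arcs connect `0` with `1`, and `2` with `3`. The arcs of the
`B`-smoothing connect `1` with `2`, and `3` with `0`. -/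
def Joined (s : State X) (e f : E) : Prop :=
  ∃ x : X,
    (s x = Marker.A ∧
      ((e = D.corner x 0 ∧ f = D.corner x 1) ∨ (e = D.corner x 2 ∧ f = D.corner x 3))) ∨
    (s x = Marker.B ∧
      ((e = D.corner x 1 ∧ f = D.corner x 2) ∨ (e = D.corner x 3 ∧ f = D.corner x 0)))

/-- The circles of `sD`: classes of edges for the equivalence relation generated by `Joined`. -/
def Circle (s : State X) : Type := Quot (D.Joined s)

/-- The circle of `sD` which contains the edge `e`. -/
def circle (s : State X) (e : E) : D.Circle s := Quot.mk _ e

instance [Finite E] (s : State X) : Finite (D.Circle s) :=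
  inferInstanceAs (Finite (Quot (D.Joined s)))

instance [Finite E] (s : State X) : Fintype (D.Circle s) := Fintype.ofFinite _

/-- An enhanced state: a Kauffman state `s` with a sign (`1` or `-1`) on each circle of `sD`. -/
def EnhancedState : Type := Σ s : State X, (D.Circle s → ℤˣ)

instance [Finite X] [Finite E] : Finite D.EnhancedState :=
  inferInstanceAs (Finite (Σ s : State X, (D.Circle s → ℤˣ)))

instance [Finite X] [Finite E] : Fintype D.EnhancedState := Fintype.ofFinite _

variable {D}

/-- The underlying Kauffman state of an enhanced state. -/
def EnhancedState.state (S : D.EnhancedState) : State X := S.1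

/-- The signs of an enhanced state. -/
def EnhancedState.sign (S : D.EnhancedState) : D.Circle S.state → ℤˣ := S.2

/-- The homological degree `i(S)`: the number of `B`-labels. -/
def EnhancedState.homDegree (S : D.EnhancedState) : ℤ :=
  ({x : X | S.state x = Marker.B}.ncard : ℤ)

/-- `θ(S)`: the number of circles with sign `+` minus the number of circles with sign `-`. -/
def EnhancedState.theta [Finite E] (S : D.EnhancedState) : ℤ :=
  ∑ c : D.Circle S.state, (S.sign c : ℤ)

/-- The quantum degree `j(S) = i(S) + θ(S)`. -/
def EnhancedState.quantumDegree [Finite E] (S : D.EnhancedState) : ℤ :=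
  S.homDegree + S.theta

variable (D)

open Classical in
/-- `T` is adjacent to `S` with change crossing `x`: the label of `x` is `A` in `S` and `B` in `T`,
all the other labels agree, the quantum degrees agree, and the signs agree on the common circles,
that is, on the circles which do not touch `x`. -/
def AdjacentAt [Finite E] (x : X) (S T : D.EnhancedState) : Prop :=
  S.state x = Marker.A ∧ T.state = Function.update S.state x Marker.B ∧
    T.quantumDegree = S.quantumDegree ∧
    ∀ e : E, (∀ q : Fin 4, D.circle S.state e ≠ D.circle S.state (D.corner x q)) →
      T.sign (D.circle T.state e) = S.sign (D.circle S.state e)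

open Classical in
/-- The incidence number of `S` over `T`: it is `(-1)^k` if `T` is adjacent to `S`, where `k` is the
number of `B`-labels of `S` at crossings previous to the change crossing, and `0` otherwise. At most
one crossing contributes to the sum. -/
def incidence [Fintype X] [LinearOrder X] [Finite E] (S T : D.EnhancedState) : ℤ :=
  ∑ x : X, if D.AdjacentAt x S T then
    (-1) ^ {y : X | S.state y = Marker.B ∧ y < x}.ncard else 0

/-- The Khovanov chain module of `D` over `ℤ`, freely generated by all the enhanced states
(the direct sum of the modules `C^{i,j}(D)` over all degrees `i` and `j`). -/
abbrev Chain : Type := D.EnhancedState →₀ ℤ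

/-- The differential of the Khovanov complex, `d(S) = ∑ i(S,T) T`. It raises the homological degree
by one and it preserves the quantum degree. -/
def d [Fintype X] [LinearOrder X] [Finite E] : D.Chain →ₗ[ℤ] D.Chain :=
  Finsupp.linearCombination ℤ
    (fun S : D.EnhancedState => ∑ T : D.EnhancedState, Finsupp.single T (D.incidence S T))

/-- The (total) Khovanov homology of the diagram, cycles modulo exact chains. Since the differential
is homogeneous, this is the direct sum over all `i`, `j` of the bigraded modules
`Kh^{i,j}(D) = ker (d : C^{i,j} → C^{i+1,j}) / im (d : C^{i-1,j} → C^{i,j})`. -/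
abbrev Kh [Fintype X] [LinearOrder X] [Finite E] : Type :=
  LinearMap.ker D.d ⧸ (LinearMap.range D.d).submoduleOf (LinearMap.ker D.d)

/-- The homology class `[V]` of a cycle `V`. -/
def homologyClass [Fintype X] [LinearOrder X] [Finite E] (V : D.Chain) (hV : D.d V = 0) : D.Kh :=
  Submodule.Quotient.mk ⟨V, LinearMap.mem_ker.mpr hV⟩

end PDCode

/-- The crossings of the pretzel diagram `D(h₁,h₂) = P(-1,…,-1,h₂)` (with `h₁` entries `-1`):
`inl k` is the crossing of the `k`-th column `-1`, and `inr k` is the `k`-th crossing of the column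
`h₂`. In the all-`A` state they are the steps of the two ladders `H₁` and `H₂`. The order is
lexicographic: first the steps of `H₁`, then the steps of `H₂`. -/
abbrev PretzelCrossing (h₁ h₂ : ℕ) : Type := Fin h₁ ⊕ₗ Fin h₂

/-- The edges of `D(h₁,h₂)`. -/
abbrev PretzelEdge (h₁ h₂ : ℕ) : Type := Fin (2 * (h₁ + h₂))

/-- The four corners of each crossing of `D(h₁,h₂)`. Edges are numbered, modulo `2(h₁+h₂)`, in the
order in which the unique circle of the all-`A` state runs through them: rightwards along the top of
the `h₁` columns `-1` (edges `0` to `h₁`), downwards along the left side of the column `h₂` (edges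
`h₁` to `h₁+h₂`), leftwards along the bottom of the columns `-1` (edges `h₁+h₂` to `2h₁+h₂`), and
upwards along the right side of the column `h₂` (edges `2h₁+h₂` to `2h₁+2h₂`, the last one being
again the edge `0`, which closes the diagram around the top).
The corners are listed as NE, NW, SW, SE for the columns `-1` (the under-strand joins NE and SW),
and as NW, SW, SE, NE for the column `h₂` (the under-strand joins NW and SE). -/
def pretzelCorner (h₁ h₂ : ℕ) (x : PretzelCrossing h₁ h₂) : Fin 4 → PretzelEdge h₁ h₂ :=
  match ofLex x with
  | Sum.inl k =>
      let edge : ℕ → PretzelEdge h₁ h₂ :=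
        fun m => ⟨m % (2 * (h₁ + h₂)), Nat.mod_lt _ (by have := k.isLt; omega)⟩
      ![edge (k + 1), edge k, edge (2 * h₁ + h₂ - k), edge (2 * h₁ + h₂ - (k + 1))]
  | Sum.inr k =>
      let edge : ℕ → PretzelEdge h₁ h₂ :=
        fun m => ⟨m % (2 * (h₁ + h₂)), Nat.mod_lt _ (by have := k.isLt; omega)⟩
      ![edge (h₁ + k), edge (h₁ + k + 1), edge (2 * h₁ + 2 * h₂ - (k + 1)),
        edge (2 * h₁ + 2 * h₂ - k)]

theorem pretzelCorner_eq_iff (h₁ h₂ : ℕ) (e : PretzelEdge h₁ h₂) (i : Fin h₁ ⊕ Fin h₂)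
    (q : Fin 4) : pretzelCorner h₁ h₂ (toLex i) q = e ↔
      match i with
      | Sum.inl k => (q = 0 ∧ (e : ℕ) = k + 1) ∨ (q = 1 ∧ (e : ℕ) = k) ∨
          (q = 2 ∧ ((e : ℕ) = 2 * h₁ + h₂ - k ∨ (h₂ = 0 ∧ (k : ℕ) = 0 ∧ (e : ℕ) = 0))) ∨
          (q = 3 ∧ (e : ℕ) = 2 * h₁ + h₂ - (k + 1))
      | Sum.inr k => (q = 0 ∧ (e : ℕ) = h₁ + k) ∨ (q = 1 ∧ (e : ℕ) = h₁ + k + 1) ∨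
          (q = 2 ∧ (e : ℕ) = 2 * h₁ + 2 * h₂ - (k + 1)) ∨
          (q = 3 ∧ ((e : ℕ) = 2 * h₁ + 2 * h₂ - k ∨ ((k : ℕ) = 0 ∧ (e : ℕ) = 0))) := by
  have he := e.isLt
  have key : ∀ m, 0 < m → m ≤ 2 * (h₁ + h₂) →
      (m % (2 * (h₁ + h₂)) = (e : ℕ) ↔ (e : ℕ) = m ∨ (m = 2 * (h₁ + h₂) ∧ (e : ℕ) = 0)) := by
    intro m hm hm'
    rcases hm'.lt_or_eq with h | h
    · rw [Nat.mod_eq_of_lt h]; omega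
    · subst h; rw [Nat.mod_self]; omega
  have key0 : ∀ m, m < 2 * (h₁ + h₂) → (m % (2 * (h₁ + h₂)) = (e : ℕ) ↔ (e : ℕ) = m) := by
    intro m hm
    rw [Nat.mod_eq_of_lt hm]; omega
  rcases i with k | k
  · have hk := k.isLt
    fin_cases q <;> simp [pretzelCorner, Fin.ext_iff]
    · rw [key0 _ (by omega)]
    · rw [key0 _ (by omega)]
    · rw [key _ (by omega) (by omega)]; omega
    · rw [key0 _ (by omega)]
  · have hk := k.isLt
    fin_cases q <;> simp [pretzelCorner, Fin.ext_iff]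
    · rw [key0 _ (by omega)]
    · rw [key0 _ (by omega)]
    · rw [key0 _ (by omega)]
    · rw [key _ (by omega) (by omega)]; omega

theorem pretzelCorner_two_ends (h₁ h₂ : ℕ) (e : PretzelEdge h₁ h₂) :
    {p : PretzelCrossing h₁ h₂ × Fin 4 | pretzelCorner h₁ h₂ p.1 p.2 = e}.ncard = 2 := by
  have he := e.isLt
  have hs : ∃ p : (Fin h₁ ⊕ Fin h₂) × Fin 4,
      ∀ i q, ((i, q) = p ↔ pretzelCorner h₁ h₂ (toLex i) q = e ∧
        match i with
        | Sum.inl _ => q = 1 ∨ q = 3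
        | Sum.inr _ => q = 0 ∨ q = 2) := by
    by_cases c1 : (e : ℕ) < h₁
    · refine ⟨(Sum.inl ⟨e, c1⟩, 1), ?_⟩
      rintro (k | k) q <;> rw [pretzelCorner_eq_iff] <;> have hk := k.isLt <;>
        simp only [Prod.mk.injEq, Sum.inl.injEq, reduceCtorEq, Fin.ext_iff] <;> simp <;> omega
    by_cases c2 : (e : ℕ) < h₁ + h₂
    · refine ⟨(Sum.inr ⟨e - h₁, by omega⟩, 0), ?_⟩
      rintro (k | k) q <;> rw [pretzelCorner_eq_iff] <;> have hk := k.isLt <;>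
        simp only [Prod.mk.injEq, Sum.inr.injEq, reduceCtorEq, Fin.ext_iff] <;> simp <;> omega
    by_cases c3 : (e : ℕ) < 2 * h₁ + h₂
    · refine ⟨(Sum.inl ⟨2 * h₁ + h₂ - 1 - e, by omega⟩, 3), ?_⟩
      rintro (k | k) q <;> rw [pretzelCorner_eq_iff] <;> have hk := k.isLt <;>
        simp only [Prod.mk.injEq, Sum.inl.injEq, reduceCtorEq, Fin.ext_iff] <;> simp <;> omega
    · refine ⟨(Sum.inr ⟨2 * h₁ + 2 * h₂ - 1 - e, by omega⟩, 2), ?_⟩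
      rintro (k | k) q <;> rw [pretzelCorner_eq_iff] <;> have hk := k.isLt <;>
        simp only [Prod.mk.injEq, Sum.inr.injEq, reduceCtorEq, Fin.ext_iff] <;> simp <;> omega
  have ht : ∃ p : (Fin h₁ ⊕ Fin h₂) × Fin 4,
      ∀ i q, ((i, q) = p ↔ pretzelCorner h₁ h₂ (toLex i) q = e ∧
        match i with
        | Sum.inl _ => q = 0 ∨ q = 2
        | Sum.inr _ => q = 1 ∨ q = 3) := by
    obtain ⟨m, hm, hm'⟩ : ∃ m, m < 2 * (h₁ + h₂) ∧
        ((e : ℕ) = m + 1 ∨ (m + 1 = 2 * (h₁ + h₂) ∧ (e : ℕ) = 0)) := by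
      by_cases h : (e : ℕ) = 0
      · exact ⟨2 * (h₁ + h₂) - 1, by omega, by omega⟩
      · exact ⟨e - 1, by omega, by omega⟩
    by_cases c1 : m < h₁
    · refine ⟨(Sum.inl ⟨m, c1⟩, 0), ?_⟩
      rintro (k | k) q <;> rw [pretzelCorner_eq_iff] <;> have hk := k.isLt <;>
        simp only [Prod.mk.injEq, Sum.inl.injEq, reduceCtorEq, Fin.ext_iff] <;> simp <;> omega
    by_cases c2 : m < h₁ + h₂
    · refine ⟨(Sum.inr ⟨m - h₁, by omega⟩, 1), ?_⟩
      rintro (k | k) q <;> rw [pretzelCorner_eq_iff] <;> have hk := k.isLt <;>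
        simp only [Prod.mk.injEq, Sum.inr.injEq, reduceCtorEq, Fin.ext_iff] <;> simp <;> omega
    by_cases c3 : m < 2 * h₁ + h₂
    · refine ⟨(Sum.inl ⟨2 * h₁ + h₂ - 1 - m, by omega⟩, 2), ?_⟩
      rintro (k | k) q <;> rw [pretzelCorner_eq_iff] <;> have hk := k.isLt <;>
        simp only [Prod.mk.injEq, Sum.inl.injEq, reduceCtorEq, Fin.ext_iff] <;> simp <;> omega
    · refine ⟨(Sum.inr ⟨2 * h₁ + 2 * h₂ - 1 - m, by omega⟩, 3), ?_⟩
      rintro (k | k) q <;> rw [pretzelCorner_eq_iff] <;> have hk := k.isLt <;>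
        simp only [Prod.mk.injEq, Sum.inr.injEq, reduceCtorEq, Fin.ext_iff] <;> simp <;> omega
  obtain ⟨⟨i, q⟩, hp⟩ := hs
  obtain ⟨⟨i', q'⟩, hp'⟩ := ht
  refine Set.ncard_eq_two.mpr ⟨(toLex i, q), (toLex i', q'), ?_, ?_⟩
  · intro h
    have h1 := ((hp i q).mp rfl).2
    have h2 := ((hp' i q).mp h).2
    rcases i with k | k <;> simp only at h1 h2 <;> omega
  · ext ⟨j, r⟩
    have h1 := hp (ofLex j) r
    have h2 := hp' (ofLex j) r
    change _ ↔ ((ofLex j, r) = (i, q) ∨ (ofLex j, r) = (i', q'))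
    rw [h1, h2, ← and_or_left]
    refine ⟨fun h => ⟨h, ?_⟩, fun h => h.1⟩
    rcases ofLex j with k | k <;> simp only <;> omega

/-- The standard diagram of the pretzel link `D(h₁,h₂) = P(-1,…,-1,h₂)`: the monocircular diagram
whose all-`A` state has one circle and two ladders, of heights `h₁` and `h₂`. -/
def pretzel (h₁ h₂ : ℕ) : PDCode (PretzelCrossing h₁ h₂) (PretzelEdge h₁ h₂) where
  corner := pretzelCorner h₁ h₂
  two_ends := pretzelCorner_two_ends h₁ h₂

variable {h₁ h₂ : ℕ}

open Classical in
/-- The Kauffman state `s(M₁,M₂;)` of `D(h₁,h₂)`: the steps of `H₁` in `M₁` and the steps of `H₂` in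
`M₂` have label `B`, and all the other crossings have label `A`. -/
def ladderState (M₁ : Finset (Fin h₁)) (M₂ : Finset (Fin h₂)) :
    State (PretzelCrossing h₁ h₂) := fun x =>
  match ofLex x with
  | Sum.inl k => if k ∈ M₁ then Marker.B else Marker.A
  | Sum.inr k => if k ∈ M₂ then Marker.B else Marker.A

/-- `c` is the circle `C₁⁰` of the state `s(M₁,M₂;)`: the periphery circle of `H₁` which touches
the first red scar of `M₁`. It is the circle through the NW corner of that crossing. -/
def IsCircleOne (M₁ : Finset (Fin h₁)) (M₂ : Finset (Fin h₂))
    (c : (pretzel h₁ h₂).Circle (ladderState M₁ M₂)) : Prop :=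
  ∃ k : Fin h₁, IsLeast (M₁ : Set (Fin h₁)) k ∧
    c = (pretzel h₁ h₂).circle (ladderState M₁ M₂)
      ((pretzel h₁ h₂).corner (toLex (Sum.inl k)) 1)

/-- `c` is the circle `C₂⁰` of the state `s(M₁,M₂;)`: the periphery circle of `H₂` which touches
the first red scar of `M₂`. It is the circle through the NW corner of that crossing. -/
def IsCircleTwo (M₁ : Finset (Fin h₁)) (M₂ : Finset (Fin h₂))
    (c : (pretzel h₁ h₂).Circle (ladderState M₁ M₂)) : Prop :=
  ∃ k : Fin h₂, IsLeast (M₂ : Set (Fin h₂)) k ∧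
    c = (pretzel h₁ h₂).circle (ladderState M₁ M₂)
      ((pretzel h₁ h₂).corner (toLex (Sum.inr k)) 0)

open Classical in
/-- The enhanced state `s(M₁,M₂;C₁⁰⁻)`: all the circles have sign `+` except `C₁⁰`. -/
def enhancedOne (M₁ : Finset (Fin h₁)) (M₂ : Finset (Fin h₂)) : (pretzel h₁ h₂).EnhancedState :=
  ⟨ladderState M₁ M₂, fun c => if IsCircleOne M₁ M₂ c then -1 else 1⟩

open Classical in
/-- The enhanced state `s(M₁,M₂;C₂⁰⁻)`: all the circles have sign `+` except `C₂⁰`. -/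
def enhancedTwo (M₁ : Finset (Fin h₁)) (M₂ : Finset (Fin h₂)) : (pretzel h₁ h₂).EnhancedState :=
  ⟨ladderState M₁ M₂, fun c => if IsCircleTwo M₁ M₂ c then -1 else 1⟩

/-- The chain `s(m₁,m₂;C₁⁰⁻)`: the sum of the enhanced states `s(M₁,M₂;C₁⁰⁻)` over all the sets
`M₁` of `m₁` steps of `H₁` and `M₂` of `m₂` steps of `H₂`. -/
def chainOne (h₁ h₂ m₁ m₂ : ℕ) : (pretzel h₁ h₂).Chain :=
  ∑ M₁ ∈ (Finset.univ : Finset (Fin h₁)).powersetCard m₁,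
    ∑ M₂ ∈ (Finset.univ : Finset (Fin h₂)).powersetCard m₂,
      Finsupp.single (enhancedOne M₁ M₂) 1

/-- The chain `s(m₁,m₂;C₂⁰⁻)`: the sum of the enhanced states `s(M₁,M₂;C₂⁰⁻)` over all the sets
`M₁` of `m₁` steps of `H₁` and `M₂` of `m₂` steps of `H₂`. -/
def chainTwo (h₁ h₂ m₁ m₂ : ℕ) : (pretzel h₁ h₂).Chain :=
  ∑ M₁ ∈ (Finset.univ : Finset (Fin h₁)).powersetCard m₁,
    ∑ M₂ ∈ (Finset.univ : Finset (Fin h₂)).powersetCard m₂,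
      Finsupp.single (enhancedTwo M₁ M₂) 1

/-- The chain `V(m₁,m₂)` of `D(h₁,h₂)` for `m₁, m₂ ≥ 2`: the sum of
`(-1)^(m₁+…+mᵢ₋₁) s(…,1+mᵢ,…;Cᵢ⁰⁻)` over the indices `i ∈ {1,2}` such that `mᵢ` is even and
`mᵢ < hᵢ`. -/
def V (h₁ h₂ m₁ m₂ : ℕ) : (pretzel h₁ h₂).Chain :=
  (if Even m₁ ∧ m₁ < h₁ then chainOne h₁ h₂ (m₁ + 1) m₂ else 0) +
    (if Even m₂ ∧ m₂ < h₂ then (-1 : ℤ) ^ m₁ • chainTwo h₁ h₂ m₁ (m₂ + 1) else 0)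

/-- The chain `V(m,0) = (-1)^m s(m,1;C₁⁰⁻)`, for `m` odd. -/
def VLeft (h₁ h₂ m : ℕ) : (pretzel h₁ h₂).Chain :=
  (-1 : ℤ) ^ m • chainOne h₁ h₂ m 1

/-- The chain `V(0,m) = s(1,m;C₂⁰⁻)`, for `m` odd. -/
def VRight (h₁ h₂ m : ℕ) : (pretzel h₁ h₂).Chain :=
  chainTwo h₁ h₂ 1 m

end Khovanov

end

noncomputable section

namespace Khovanov

/-! ### Relabelling a crossing that splits a circle, in an arbitrary diagram -/

namespace PDCode

variable {X E : Type} {D : PDCode X E}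

/-! As soon as both ladders carry a `B`-label, the circles of a state have a simple shape: one outer
circle, touching the first and last red scars of both ladders, and one inner circle between each two
consecutive red scars of a ladder. So `C₁⁰` and `C₂⁰` are both the outer circle, and every chain of
the statement is, up to signs, a sum of chains `chainOne h₁ h₂ m₁ m₂` with `m₁, m₂ ≥ 1`. Moreover,
adding a `B`-label to such a state always splits a circle, never merges two (`isSplit_inl`,
`isSplit_inr`).

Each of these chains is a cycle (`d_chainOne`). A state occurring in the differential of a summand
has exactly two negative circles, the outer one and an inner one. It is reached by adding either of
the two scars that bound the inner circle; these are consecutive in their ladder, so the two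
incidence numbers are opposite. Formally the sum telescopes along the ladder (`sum_ladder_eq_zero`).

The classes are separated by a parity. Fix a Kauffman state with at least two `B`-labels in each
ladder, and add the coefficients of a chain over the enhancements with exactly one negative circle
(`minusCount`). Every relabelling that ends at this state is a split, and a split creates a single
minus only from an all-plus state, by putting it on either of the two new circles, with the same
incidence number. The count of a boundary is therefore even (`minusCount_d`). On `chainOne h₁ h₂ m₁
m₂` the count is `1` if the fixed state has `m₁` and `m₂` labels `B` in the two ladders, and `0`
otherwise. It is thus odd on `V(μ₁,μ₂)` for a suitable state (`exists_minusCount_V`), whereas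
`V(μ,0)` and `V(0,μ)` have a single `B`-label in one of the ladders and count zero. -/

theorem circle_eq_of_joined {s : State X} {e f : E} (h : D.Joined s e f) :
    D.circle s e = D.circle s f := Quot.sound h

theorem circle_surjective (s : State X) : Function.Surjective (D.circle s) := Quot.exists_rep

theorem AdjacentAt.labels [Finite E] {x : X} {s s' : State X} {σ τ}
    (h : D.AdjacentAt x ⟨s, σ⟩ ⟨s', τ⟩) :
    s x = Marker.A ∧ s' x = Marker.B ∧ ∀ y, y ≠ x → s' y = s y := by
  classical
  obtain ⟨hA, hB, -⟩ := h
  exact ⟨hA, (congrFun hB x).trans (Function.update_self ..),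
    fun y hy => (congrFun hB y).trans (Function.update_of_ne hy ..)⟩

/-- Relabelling the crossing `x` of `s` from `A` to `B`, which gives `s'`, splits the circle of `s`
touching `x` into the two circles of `s'` through the edges `a` and `b`, and keeps all the others. -/
structure IsSplit (D : PDCode X E) (x : X) (s s' : State X) (a b : E) : Prop where
  label : s x = Marker.A
  label' : s' x = Marker.B
  label_of_ne : ∀ y, y ≠ x → s' y = s y
  corner : ∀ q, D.circle s (D.corner x q) = D.circle s a
  ne : D.circle s' a ≠ D.circle s' b
  circle_eq_iff : ∀ e f, D.circle s e = D.circle s f ↔ D.circle s' e = D.circle s' f ∨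
    ((D.circle s' e = D.circle s' a ∨ D.circle s' e = D.circle s' b) ∧
      (D.circle s' f = D.circle s' a ∨ D.circle s' f = D.circle s' b))

namespace IsSplit

variable {x : X} {s s' : State X} {a b : E}

theorem touch_iff (h : D.IsSplit x s s' a b) (e : E) : D.circle s e = D.circle s a ↔
    (D.circle s' e = D.circle s' a ∨ D.circle s' e = D.circle s' b) := by
  rw [h.circle_eq_iff]; tauto

open Classical in
theorem eq_update (h : D.IsSplit x s s' a b) : s' = Function.update s x Marker.B := by
  funext y
  by_cases hy : y = x
  · subst hy; simp [h.label']
  · simp [hy, h.label_of_ne y hy]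

/-- The circle of `s` which contains, or is equal to, a circle of `s'`. -/
def proj (h : D.IsSplit x s s' a b) : D.Circle s' → D.Circle s :=
  Quot.lift (D.circle s) (fun e f hj => (h.circle_eq_iff e f).mpr (Or.inl (Quot.sound hj)))

theorem proj_circle (h : D.IsSplit x s s' a b) (e : E) :
    h.proj (D.circle s' e) = D.circle s e := rfl

/-- The fibre of `proj` over the split circle consists of the two new circles, and every other fibre
is a single circle, where the terms cancel. -/
theorem sum_sub_sum [Finite E] (h : D.IsSplit x s s' a b) (f : D.Circle s → ℤ)
    (g : D.Circle s' → ℤ)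
    (hfg : ∀ e, D.circle s e ≠ D.circle s a → g (D.circle s' e) = f (D.circle s e)) :
    ∑ c, g c - ∑ c, f c = g (D.circle s' a) + g (D.circle s' b) - f (D.circle s a) := by
  classical
  rw [← Finset.sum_fiberwise Finset.univ h.proj g, ← Finset.sum_sub_distrib,
    Finset.sum_eq_single (D.circle s a)]
  · congr 1
    rw [← Finset.sum_pair h.ne]
    refine Finset.sum_congr ?_ fun _ _ => rfl
    ext c
    obtain ⟨e, rfl⟩ := circle_surjective s' c
    simp [proj_circle, h.touch_iff]
  · intro c _ hc
    obtain ⟨e, rfl⟩ := circle_surjective s c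
    rw [Finset.sum_eq_single (D.circle s' e), hfg e hc, sub_self]
    · intro c' hc' hne
      obtain ⟨e', rfl⟩ := circle_surjective s' c'
      simp only [Finset.mem_filter, Finset.mem_univ, true_and, proj_circle,
        h.circle_eq_iff] at hc'
      rw [Ne, h.touch_iff] at hc
      tauto
    · simp [proj_circle]
  · simp

theorem homDegree [Finite X] (h : D.IsSplit x s s' a b) (σ : D.Circle s → ℤˣ)
    (τ : D.Circle s' → ℤˣ) :
    EnhancedState.homDegree (D := D) ⟨s', τ⟩ = EnhancedState.homDegree (D := D) ⟨s, σ⟩ + 1 := by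
  have : {y : X | s' y = Marker.B} = insert x {y : X | s y = Marker.B} := by
    ext y
    by_cases hy : y = x
    · subst hy; simp [h.label']
    · simp [hy, h.label_of_ne y hy]
  change (({y : X | s' y = Marker.B}.ncard : ℕ) : ℤ) = ({y : X | s y = Marker.B}.ncard : ℤ) + 1
  rw [this, Set.ncard_insert_of_notMem (by simp [h.label]) (Set.toFinite _)]
  push_cast; rfl

/-- The number of `B`-labels rises by one, so keeping the quantum degree means lowering `θ` by one,
and only the split circle and its two pieces affect `θ`. -/
theorem adjacentAt_iff [Finite X] [Finite E] (h : D.IsSplit x s s' a b) (σ : D.Circle s → ℤˣ)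
    (τ : D.Circle s' → ℤˣ) : D.AdjacentAt x ⟨s, σ⟩ ⟨s', τ⟩ ↔
      (∀ e, D.circle s e ≠ D.circle s a → τ (D.circle s' e) = σ (D.circle s e)) ∧
      (τ (D.circle s' a) + τ (D.circle s' b) : ℤ) = σ (D.circle s a) - 1 := by
  have hq : ∀ e, (∀ q : Fin 4, D.circle s e ≠ D.circle s (D.corner x q)) ↔
      D.circle s e ≠ D.circle s a := fun e => by simp [h.corner]
  have key : (∀ e, D.circle s e ≠ D.circle s a → τ (D.circle s' e) = σ (D.circle s e)) →
      (EnhancedState.quantumDegree (D := D) ⟨s', τ⟩ = EnhancedState.quantumDegree (D := D) ⟨s, σ⟩ ↔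
        (τ (D.circle s' a) + τ (D.circle s' b) : ℤ) = σ (D.circle s a) - 1) := by
    intro hag
    have := h.sum_sub_sum (fun c => (σ c : ℤ)) (fun c => (τ c : ℤ))
      (fun e he => by simp only [hag e he])
    have hd := h.homDegree σ τ
    unfold EnhancedState.quantumDegree
    rw [hd]
    change _ + (∑ c : D.Circle s', (τ c : ℤ)) = _ + (∑ c : D.Circle s, (σ c : ℤ)) ↔ _
    constructor <;> intro h' <;> linarith
  unfold AdjacentAt
  change (s x = _ ∧ s' = _ ∧ _ ∧ ∀ e, (∀ q : Fin 4, D.circle s e ≠ D.circle s (D.corner x q)) →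
    τ (D.circle s' e) = σ (D.circle s e)) ↔ _
  simp only [hq]
  constructor
  · rintro ⟨-, -, h1, h2⟩
    exact ⟨h2, (key h2).mp h1⟩
  · rintro ⟨h1, h2⟩
    exact ⟨h.label, h.eq_update, (key h1).mpr h2, h1⟩

theorem units_add_eq_zero_iff (u v : ℤˣ) :
    (u + v : ℤ) = 0 ↔ (u = -1 ∧ v = 1) ∨ (u = 1 ∧ v = -1) := by
  rcases Int.units_eq_one_or u with rfl | rfl <;> rcases Int.units_eq_one_or v with rfl | rfl <;>
    simp

theorem units_add_eq_neg_two_iff (u v : ℤˣ) : (u + v : ℤ) = -2 ↔ u = -1 ∧ v = -1 := by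
  rcases Int.units_eq_one_or u with rfl | rfl <;> rcases Int.units_eq_one_or v with rfl | rfl <;>
    simp

/-- With only one minus available the two pieces cannot both be negative. Hence their signs are
opposite and the split circle was positive, which forces all the other circles to be positive too.
-/
theorem adjacentAt_single_iff [Finite X] [Finite E] [DecidableEq (D.Circle s')]
    (h : D.IsSplit x s s' a b) (σ : D.Circle s → ℤˣ) (c : D.Circle s') :
    D.AdjacentAt x ⟨s, σ⟩ ⟨s', fun c' => if c' = c then -1 else 1⟩ ↔
      (∀ c, σ c = 1) ∧ (c = D.circle s' a ∨ c = D.circle s' b) := by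
  rw [h.adjacentAt_iff]
  have hne := h.ne
  constructor
  · rintro ⟨h1, h2⟩
    have hc : c = D.circle s' a ∨ c = D.circle s' b := by
      by_contra hc
      push Not at hc
      rw [if_neg hc.1.symm, if_neg hc.2.symm] at h2
      rcases Int.units_eq_one_or (σ (D.circle s a)) with h3 | h3 <;> rw [h3] at h2 <;> simp at h2
    refine ⟨fun c' => ?_, hc⟩
    obtain ⟨e, rfl⟩ := circle_surjective s c'
    by_cases he : D.circle s e = D.circle s a
    · rw [he]
      rcases Int.units_eq_one_or (σ (D.circle s a)) with h3 | h3
      · exact h3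
      · rcases hc with rfl | rfl <;> simp [h3, hne, hne.symm] at h2
    · rw [← h1 e he, if_neg]
      rw [h.touch_iff] at he
      rintro rfl
      tauto
  · rintro ⟨h1, h2⟩
    refine ⟨fun e he => ?_, ?_⟩
    · rw [h1, if_neg]
      rw [Ne, h.touch_iff] at he
      rintro rfl
      tauto
    · rw [h1]
      rcases h2 with rfl | rfl <;> simp [hne, hne.symm]

/-- There are two cases with one outcome. If the negative circle (through `o`) is split, both pieces
become negative; if a positive circle is split, exactly one piece does. Either way the negative
circles of the target are the one through `o` and one further piece. -/
theorem adjacentAt_outer_iff [Finite X] [Finite E] (h : D.IsSplit x s s' a b) (o : E)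
    (σ : D.Circle s → ℤˣ) (hσ : ∀ c, σ c = -1 ↔ c = D.circle s o) (τ : D.Circle s' → ℤˣ) :
    D.AdjacentAt x ⟨s, σ⟩ ⟨s', τ⟩ ↔
      ∃ e, (e = a ∨ e = b) ∧ D.circle s' e ≠ D.circle s' o ∧
        ∀ c, τ c = -1 ↔ c = D.circle s' o ∨ c = D.circle s' e := by
  rw [h.adjacentAt_iff]
  have hne := h.ne
  have hσ1 : ∀ c, c ≠ D.circle s o → σ c = 1 := fun c hc =>
    (Int.units_eq_one_or _).resolve_right fun h' => hc ((hσ c).mp h')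
  have hτ1 : ∀ c, ¬ τ c = -1 ↔ τ c = 1 := fun c => by
    rcases Int.units_eq_one_or (τ c) with h' | h' <;> rw [h'] <;> decide
  by_cases ho : D.circle s o = D.circle s a
  · have hsa : σ (D.circle s a) = -1 := (hσ _).mpr ho.symm
    have ho' := (h.touch_iff o).mp ho
    have hoff : ∀ e, D.circle s e ≠ D.circle s a → σ (D.circle s e) = 1 := fun e he =>
      hσ1 _ (by rw [ho]; exact he)
    rw [hsa]
    have : (((-1 : ℤˣ) : ℤ) - 1) = -2 := by norm_num
    rw [this, units_add_eq_neg_two_iff]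
    have main : ((∀ e, D.circle s e ≠ D.circle s a → τ (D.circle s' e) = σ (D.circle s e)) ∧
        τ (D.circle s' a) = -1 ∧ τ (D.circle s' b) = -1) ↔
        ∀ c, τ c = -1 ↔ c = D.circle s' a ∨ c = D.circle s' b := by
      constructor
      · rintro ⟨h1, h2, h3⟩ c
        obtain ⟨e, rfl⟩ := circle_surjective s' c
        rw [← h.touch_iff]
        by_cases he : D.circle s e = D.circle s a
        · simp only [he, iff_true]
          rcases (h.touch_iff e).mp he with h' | h' <;> rw [h'] <;> assumption
        · simp only [he, iff_false]
          rw [h1 e he, hoff e he]; decide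
      · intro h1
        refine ⟨fun e he => ?_, (h1 _).mpr (Or.inl rfl), (h1 _).mpr (Or.inr rfl)⟩
        rw [hoff e he, ← hτ1, h1, ← h.touch_iff]
        exact he
    rw [main]
    rcases ho' with ho' | ho' <;> rw [ho']
    · constructor
      · intro h1
        exact ⟨b, Or.inr rfl, hne.symm, h1⟩
      · rintro ⟨e, rfl | rfl, h2, h3⟩
        · exact absurd rfl h2
        · exact h3
    · constructor
      · intro h1
        exact ⟨a, Or.inl rfl, hne, fun c => (h1 c).trans or_comm⟩
      · rintro ⟨e, rfl | rfl, h2, h3⟩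
        · exact fun c => (h3 c).trans or_comm
        · exact absurd rfl h2
  · have hsa : σ (D.circle s a) = 1 := hσ1 _ (Ne.symm ho)
    have ho' := ho
    rw [h.touch_iff] at ho'
    push Not at ho'
    rw [hsa]
    have : (((1 : ℤˣ) : ℤ) - 1) = 0 := by norm_num
    rw [this, units_add_eq_zero_iff]
    have hoff : ∀ e, D.circle s e ≠ D.circle s a →
        (σ (D.circle s e) = -1 ↔ D.circle s' e = D.circle s' o) := fun e he => by
      rw [hσ, h.circle_eq_iff]
      tauto
    constructor
    · rintro ⟨h1, h2⟩
      have hc : ∀ e, D.circle s e ≠ D.circle s a →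
          (τ (D.circle s' e) = -1 ↔ D.circle s' e = D.circle s' o) := fun e he => by
        rw [h1 e he, hoff e he]
      rcases h2 with ⟨h2, h3⟩ | ⟨h2, h3⟩
      · refine ⟨a, Or.inl rfl, ho'.1.symm, fun c => ?_⟩
        obtain ⟨e, rfl⟩ := circle_surjective s' c
        by_cases he : D.circle s e = D.circle s a
        · rcases (h.touch_iff e).mp he with h' | h' <;> rw [h']
          · simp [h2]
          · simp [h3, hne.symm, ho'.2.symm]
        · rw [hc e he]
          rw [h.touch_iff] at he
          tauto
      · refine ⟨b, Or.inr rfl, ho'.2.symm, fun c => ?_⟩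
        obtain ⟨e, rfl⟩ := circle_surjective s' c
        by_cases he : D.circle s e = D.circle s a
        · rcases (h.touch_iff e).mp he with h' | h' <;> rw [h']
          · simp [h2, hne, ho'.1.symm]
          · simp [h3]
        · rw [hc e he]
          rw [h.touch_iff] at he
          tauto
    · rintro ⟨f, hf, h2, h3⟩
      refine ⟨fun e he => ?_, ?_⟩
      · have h4 := hoff e he
        have h5 := h3 (D.circle s' e)
        have h6 : D.circle s' e ≠ D.circle s' f := by
          rw [Ne, h.touch_iff] at he
          rcases hf with rfl | rfl <;> tauto
        rcases Int.units_eq_one_or (τ (D.circle s' e)) with h7 | h7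
        · rw [h7]
          refine ((Int.units_eq_one_or _).resolve_right fun h8 => ?_).symm
          rw [h5.mpr (Or.inl (h4.mp h8))] at h7
          exact absurd h7 (by decide)
        · rw [h7]
          exact (h4.mpr ((h5.mp h7).resolve_right h6)).symm
      · rcases hf with rfl | rfl
        · exact Or.inl ⟨(h3 _).mpr (Or.inr rfl), (hτ1 _).mp (by rw [h3]; tauto)⟩
        · exact Or.inr ⟨(hτ1 _).mp (by rw [h3]; tauto), (h3 _).mpr (Or.inr rfl)⟩

end IsSplit

variable [Fintype X] [LinearOrder X] [Finite E]

theorem d_single_apply (S T : D.EnhancedState) (n : ℤ) :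
    D.d (Finsupp.single S n) T = n * D.incidence S T := by
  classical
  simp [d, Finsupp.linearCombination_single, Finsupp.single_apply]

end PDCode

/-! ### Positions along a ladder and their ranks -/

/-- The number of steps of `M` which precede the position `i` of the ladder. -/
def rank {h : ℕ} (M : Finset (Fin h)) (i : ℕ) : ℕ := (M.filter (fun k : Fin h => (k : ℕ) < i)).card

section rank

variable {h : ℕ} (M : Finset (Fin h))

theorem rank_zero : rank M 0 = 0 := by simp [rank]

theorem rank_le_card (i : ℕ) : rank M i ≤ M.card := Finset.card_filter_le _ _

theorem rank_top : rank M h = M.card := by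
  simp [rank]

theorem rank_mono : Monotone (rank M) := fun _ _ hij =>
  Finset.card_le_card (Finset.monotone_filter_right M (fun _ _ hk => lt_of_lt_of_le hk hij))

theorem rank_succ (k : Fin h) : rank M (k + 1) = rank M k + if k ∈ M then 1 else 0 := by
  have : M.filter (fun j : Fin h => (j : ℕ) < k + 1) =
      M.filter (fun j : Fin h => (j : ℕ) < k) ∪ M.filter (fun j => j = k) := by
    ext j; simp only [Finset.mem_filter, Finset.mem_union, Fin.ext_iff]; grind
  unfold rank
  rw [this, Finset.card_union_of_disjoint]
  · congr 1
    rw [Finset.filter_eq']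
    split_ifs <;> simp
  · rw [Finset.disjoint_left]
    intro j; simp only [Finset.mem_filter, Fin.ext_iff]; omega

theorem rank_erase {k : Fin h} (hk : k ∈ M) (i : ℕ) :
    rank (M.erase k) i + (if (k : ℕ) < i then 1 else 0) = rank M i := by
  unfold rank
  rw [Finset.filter_erase]
  split_ifs with hi
  · exact Finset.card_erase_add_one (by simp [hk, hi])
  · rw [Finset.erase_eq_of_notMem (by simp [hi])]; rfl

/-- The place of the position `i` among the circles cut out by the steps in `M`: the number of the
preceding steps, with the two ends of the ladder identified. -/
def cyclicRank (i : ℕ) : ℕ := if rank M i = M.card then 0 else rank M i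

theorem cyclicRank_zero : cyclicRank M 0 = 0 := by
  simp [cyclicRank, rank_zero]

theorem cyclicRank_top : cyclicRank M h = 0 := by
  simp [cyclicRank, rank_top]

theorem cyclicRank_succ_of_notMem {k : Fin h} (hk : k ∉ M) :
    cyclicRank M (k + 1) = cyclicRank M k := by
  simp [cyclicRank, rank_succ, hk]

/-- With a single step both sides would get place `0`; two steps are what makes adding a scar a
split. -/
theorem cyclicRank_succ_ne {k : Fin h} (hk : k ∈ M) (hM : 2 ≤ M.card) :
    cyclicRank M k ≠ cyclicRank M (k + 1) := by
  have h1 := rank_succ M k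
  have h2 := rank_le_card M (k + 1)
  simp only [hk, if_true] at h1
  simp only [cyclicRank]
  split_ifs <;> omega

/-- Erasing `k` lowers by one the ranks of the positions after it, so the places on its two sides
merge and no others do. -/
theorem cyclicRank_erase_eq_iff {k : Fin h} (hk : k ∈ M) (hM : 2 ≤ M.card) (i j : ℕ) :
    cyclicRank (M.erase k) i = cyclicRank (M.erase k) j ↔ cyclicRank M i = cyclicRank M j ∨
      ((cyclicRank M i = cyclicRank M k ∨ cyclicRank M i = cyclicRank M (k + 1)) ∧
        (cyclicRank M j = cyclicRank M k ∨ cyclicRank M j = cyclicRank M (k + 1))) := by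
  have h1 := rank_succ M k
  simp only [hk, if_true] at h1
  have h2 := rank_le_card M (k + 1)
  have hi := rank_erase M hk i
  have hj := rank_erase M hk j
  have hi' := rank_le_card M i
  have hj' := rank_le_card M j
  have hc := Finset.card_erase_add_one hk
  have mono : ∀ n, if (k : ℕ) < n then rank M k + 1 ≤ rank M n else rank M n ≤ rank M k := by
    intro n
    split_ifs with hn
    · rw [← h1]; exact rank_mono M hn
    · exact rank_mono M (by omega)
  have mi := mono i
  have mj := mono j
  simp only [cyclicRank, h1]
  rw [h1] at h2
  -- Only inequalities between ranks matter from here on: each position lies before or after `k`.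
  generalize rank M k = r at *
  generalize rank M i = u at *
  generalize rank M j = v at *
  generalize rank (M.erase k) i = u' at *
  generalize rank (M.erase k) j = v' at *
  generalize (M.erase k).card = m' at *
  generalize M.card = m at *
  clear h1 mono
  by_cases ci : (k : ℕ) < i <;> by_cases cj : (k : ℕ) < j <;>
    simp only [ci, cj, if_true, if_false] at hi hj mi mj <;> clear ci cj <;> subst hc hi hj <;>
    split_ifs <;> first | omega | grind

end rank

section ladder

variable {α : Type*} {h : ℕ} {M : Finset (Fin h)} {p q : ℕ → α}

theorem eq_of_rank_eq (hA : ∀ k : Fin h, k ∉ M → p k = p (k + 1)) {i j : ℕ} (hi : i ≤ h)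
    (hj : j ≤ h) (hij : rank M i = rank M j) : p i = p j := by
  wlog hle : i ≤ j generalizing i j
  · exact (this hj hi hij.symm (by omega)).symm
  induction j, hle using Nat.le_induction with
  | base => rfl
  | succ j hle ih =>
    have h1 := rank_mono M hle
    have h2 := rank_succ M ⟨j, hj⟩
    simp only at h2
    have h3 : (⟨j, hj⟩ : Fin h) ∉ M := by
      intro hm
      simp only [hm, if_true] at h2
      omega
    simp only [h3, if_false] at h2
    rw [ih (by omega) (by omega)]
    exact hA ⟨j, hj⟩ h3

/-- `A`-steps carry the equality of the two sides along the ladder in both directions, and a single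
`B`-step establishes it. -/
theorem left_eq_right (hA : ∀ k : Fin h, k ∉ M → p k = p (k + 1) ∧ q k = q (k + 1))
    (hB : ∀ k : Fin h, k ∈ M → p k = q k ∧ p (k + 1) = q (k + 1)) (hM : M.Nonempty) {i : ℕ}
    (hi : i ≤ h) : p i = q i := by
  have key : ∀ i ≤ h, (p i = q i ↔ p 0 = q 0) := by
    intro i hi
    induction i with
    | zero => rfl
    | succ i ih =>
      rw [← ih (by omega)]
      by_cases hm : (⟨i, hi⟩ : Fin h) ∈ M
      · exact iff_of_true (hB _ hm).2 (hB _ hm).1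
      · rw [(hA _ hm).1.symm, (hA _ hm).2.symm]
  obtain ⟨k, hk⟩ := hM
  exact (key i hi).mpr ((key k k.isLt.le).mp (hB k hk).1)

end ladder

/-! ### Circles of a state with `B`-labels in both ladders -/

/-- The position in the ladder `H₁` of an edge; the sides of `H₂` are at the ends of `H₁`. -/
def posOne (h₁ h₂ e : ℕ) : ℕ := if e ≤ h₁ + h₂ then min e h₁ else 2 * h₁ + h₂ - e

/-- The position in the ladder `H₂` of an edge; the sides of `H₁` are at the ends of `H₂`. -/
def posTwo (h₁ h₂ e : ℕ) : ℕ :=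
  -- Truncated subtraction sends the edges before `h₁` to position `0`.
  if e ≤ 2 * h₁ + h₂ then min (e - h₁) h₂ else 2 * h₁ + 2 * h₂ - e

variable {h₁ h₂ : ℕ}

/-- The edge with number `n`, modulo the number of edges. -/
def edge (hh : 0 < h₁ + h₂) (n : ℕ) : PretzelEdge h₁ h₂ :=
  ⟨n % (2 * (h₁ + h₂)), Nat.mod_lt _ (by omega)⟩

theorem edge_val (hh : 0 < h₁ + h₂) (e : PretzelEdge h₁ h₂) : edge hh e = e :=
  Fin.ext (Nat.mod_eq_of_lt e.isLt)

theorem edge_top (hh : 0 < h₁ + h₂) : edge hh (2 * h₁ + 2 * h₂) = edge hh 0 :=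
  Fin.ext (by simp [edge, ← mul_add])

/-- The label of an edge, which determines its circle in the state `s(M₁,M₂;)`. -/
def edgeLabel (M₁ : Finset (Fin h₁)) (M₂ : Finset (Fin h₂)) (e : PretzelEdge h₁ h₂) : ℕ × ℕ :=
  (cyclicRank M₁ (posOne h₁ h₂ e), cyclicRank M₂ (posTwo h₁ h₂ e))

section label

variable (hh : 0 < h₁ + h₂) (M₁ : Finset (Fin h₁)) (M₂ : Finset (Fin h₂))

theorem edgeLabel_edge {n : ℕ} (hn : n ≤ 2 * h₁ + 2 * h₂) : edgeLabel M₁ M₂ (edge hh n) =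
    (cyclicRank M₁ (posOne h₁ h₂ n), cyclicRank M₂ (posTwo h₁ h₂ n)) := by
  rcases hn.lt_or_eq with h | rfl
  · simp only [edgeLabel, edge, Nat.mod_eq_of_lt (show n < 2 * (h₁ + h₂) by omega)]
  · rw [edge_top]
    have h1 : posOne h₁ h₂ (2 * h₁ + 2 * h₂) = 0 := by
      unfold posOne; split_ifs <;> omega
    have h2 : posTwo h₁ h₂ (2 * h₁ + 2 * h₂) = 0 := by
      unfold posTwo; split_ifs <;> omega
    rw [h1, h2]
    simp [edgeLabel, edge, posOne, posTwo]

theorem edgeLabel_one_left {i : ℕ} (hi : i ≤ h₁) :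
    edgeLabel M₁ M₂ (edge hh i) = (cyclicRank M₁ i, 0) := by
  rw [edgeLabel_edge hh M₁ M₂ (by omega),
    show posOne h₁ h₂ i = i by unfold posOne; split_ifs <;> omega,
    show posTwo h₁ h₂ i = 0 by unfold posTwo; split_ifs <;> omega, cyclicRank_zero]

theorem edgeLabel_one_right (h2 : 0 < h₂) {i : ℕ} (hi : i ≤ h₁) :
    edgeLabel M₁ M₂ (edge hh (2 * h₁ + h₂ - i)) = (cyclicRank M₁ i, 0) := by
  rw [edgeLabel_edge hh M₁ M₂ (by omega),
    show posOne h₁ h₂ (2 * h₁ + h₂ - i) = i by unfold posOne; split_ifs <;> omega,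
    show posTwo h₁ h₂ (2 * h₁ + h₂ - i) = h₂ by unfold posTwo; split_ifs <;> omega,
    cyclicRank_top]

theorem edgeLabel_two_left {i : ℕ} (hi : i ≤ h₂) :
    edgeLabel M₁ M₂ (edge hh (h₁ + i)) = (0, cyclicRank M₂ i) := by
  rw [edgeLabel_edge hh M₁ M₂ (by omega),
    show posOne h₁ h₂ (h₁ + i) = h₁ by unfold posOne; split_ifs <;> omega,
    show posTwo h₁ h₂ (h₁ + i) = i by unfold posTwo; split_ifs <;> omega, cyclicRank_top]

theorem edgeLabel_two_right (h1 : 0 < h₁) {i : ℕ} (hi : i ≤ h₂) :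
    edgeLabel M₁ M₂ (edge hh (2 * h₁ + 2 * h₂ - i)) = (0, cyclicRank M₂ i) := by
  rw [edgeLabel_edge hh M₁ M₂ (by omega),
    show posOne h₁ h₂ (2 * h₁ + 2 * h₂ - i) = 0 by unfold posOne; split_ifs <;> omega,
    show posTwo h₁ h₂ (2 * h₁ + 2 * h₂ - i) = i by unfold posTwo; split_ifs <;> omega,
    cyclicRank_zero]

end label

theorem corner_inl (hh : 0 < h₁ + h₂) (k : Fin h₁) :
    (pretzel h₁ h₂).corner (toLex (Sum.inl k)) = ![edge hh (k + 1), edge hh k,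
      edge hh (2 * h₁ + h₂ - k), edge hh (2 * h₁ + h₂ - (k + 1))] := rfl

theorem corner_inr (hh : 0 < h₁ + h₂) (k : Fin h₂) :
    (pretzel h₁ h₂).corner (toLex (Sum.inr k)) = ![edge hh (h₁ + k), edge hh (h₁ + (k + 1)),
      edge hh (2 * h₁ + 2 * h₂ - (k + 1)), edge hh (2 * h₁ + 2 * h₂ - k)] := rfl

section state

variable (M₁ : Finset (Fin h₁)) (M₂ : Finset (Fin h₂))

theorem ladderState_inl (k : Fin h₁) :
    ladderState M₁ M₂ (toLex (Sum.inl k)) = if k ∈ M₁ then Marker.B else Marker.A := by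
  simp [ladderState]

theorem ladderState_inr (k : Fin h₂) :
    ladderState M₁ M₂ (toLex (Sum.inr k)) = if k ∈ M₂ then Marker.B else Marker.A := by
  simp [ladderState]

theorem ladderState_inl_eq_B (k : Fin h₁) :
    ladderState M₁ M₂ (toLex (Sum.inl k)) = Marker.B ↔ k ∈ M₁ := by
  simp [ladderState_inl]

theorem ladderState_inr_eq_B (k : Fin h₂) :
    ladderState M₁ M₂ (toLex (Sum.inr k)) = Marker.B ↔ k ∈ M₂ := by
  simp [ladderState_inr]

theorem ladderState_inl_eq_A (k : Fin h₁) :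
    ladderState M₁ M₂ (toLex (Sum.inl k)) = Marker.A ↔ k ∉ M₁ := by
  simp [ladderState_inl]

theorem ladderState_inr_eq_A (k : Fin h₂) :
    ladderState M₁ M₂ (toLex (Sum.inr k)) = Marker.A ↔ k ∉ M₂ := by
  simp [ladderState_inr]

variable {M₁ M₂} in
theorem ladderState_inj {N₁ : Finset (Fin h₁)} {N₂ : Finset (Fin h₂)} :
    ladderState M₁ M₂ = ladderState N₁ N₂ ↔ M₁ = N₁ ∧ M₂ = N₂ := by
  constructor
  · intro h
    constructor <;> ext k
    · rw [← ladderState_inl_eq_B M₁ M₂, h, ladderState_inl_eq_B]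
    · rw [← ladderState_inr_eq_B M₁ M₂, h, ladderState_inr_eq_B]
  · rintro ⟨rfl, rfl⟩; rfl

theorem exists_eq_ladderState (s : State (PretzelCrossing h₁ h₂)) :
    ∃ M₁ M₂, s = ladderState M₁ M₂ := by
  classical
  refine ⟨Finset.univ.filter fun k => s (toLex (Sum.inl k)) = Marker.B,
    Finset.univ.filter fun k => s (toLex (Sum.inr k)) = Marker.B, ?_⟩
  funext x
  obtain ⟨x, rfl⟩ := toLex.surjective x
  rcases x with k | k
  · rw [ladderState_inl]
    simp only [Finset.mem_filter, Finset.mem_univ, true_and]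
    split_ifs with h
    · exact h
    · cases h' : s (toLex (Sum.inl k)) <;> simp_all
  · rw [ladderState_inr]
    simp only [Finset.mem_filter, Finset.mem_univ, true_and]
    split_ifs with h
    · exact h
    · cases h' : s (toLex (Sum.inr k)) <;> simp_all

variable {M₁ M₂}

/-- An arc at an `A`-step runs along one side without passing a scar of `M`; an arc at a `B`-step
crosses the ladder at a fixed position. Neither changes the label. -/
theorem edgeLabel_eq_of_joined (h1 : 0 < h₁) (h2 : 0 < h₂) {e f : PretzelEdge h₁ h₂}
    (h : (pretzel h₁ h₂).Joined (ladderState M₁ M₂) e f) :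
    edgeLabel M₁ M₂ e = edgeLabel M₁ M₂ f := by
  have hh : 0 < h₁ + h₂ := by omega
  obtain ⟨x, hx⟩ := h
  obtain ⟨x, rfl⟩ := toLex.surjective x
  rcases x with k | k
  · have hk := k.isLt
    rw [ladderState_inl_eq_A, ladderState_inl_eq_B, corner_inl hh] at hx
    rcases hx with ⟨hm, ⟨rfl, rfl⟩ | ⟨rfl, rfl⟩⟩ | ⟨hm, ⟨rfl, rfl⟩ | ⟨rfl, rfl⟩⟩ <;>
      simp [edgeLabel_one_left, edgeLabel_one_right, h2, hk.le, Nat.succ_le_of_lt hk,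
        cyclicRank_succ_of_notMem, hm]
  · have hk := k.isLt
    rw [ladderState_inr_eq_A, ladderState_inr_eq_B, corner_inr hh] at hx
    rcases hx with ⟨hm, ⟨rfl, rfl⟩ | ⟨rfl, rfl⟩⟩ | ⟨hm, ⟨rfl, rfl⟩ | ⟨rfl, rfl⟩⟩ <;>
      simp [edgeLabel_two_left, edgeLabel_two_right, h1, hk.le, Nat.succ_le_of_lt hk,
        cyclicRank_succ_of_notMem, hm]

/-- The label is constant on arcs, so it descends to circles. Conversely, a `B`-step in each ladder
connects its two sides, every edge is thereby moved to the left side of a ladder, and positions of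
equal rank there are connected by `A`-arcs. The ends of both ladders lie on one circle, which
accounts for the place `0`. -/
theorem circle_eq_iff (hM₁ : M₁.Nonempty) (hM₂ : M₂.Nonempty) (e f : PretzelEdge h₁ h₂) :
    (pretzel h₁ h₂).circle (ladderState M₁ M₂) e = (pretzel h₁ h₂).circle (ladderState M₁ M₂) f ↔
      edgeLabel M₁ M₂ e = edgeLabel M₁ M₂ f := by
  have h1 : 0 < h₁ := Fin.pos hM₁.choose
  have h2 : 0 < h₂ := Fin.pos hM₂.choose
  have hh : 0 < h₁ + h₂ := by omega
  constructor
  · intro h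
    exact congrArg (Quot.lift (edgeLabel M₁ M₂) fun _ _ hj => edgeLabel_eq_of_joined h1 h2 hj) h
  · set C : ℕ → (pretzel h₁ h₂).Circle (ladderState M₁ M₂) :=
      fun n => (pretzel h₁ h₂).circle (ladderState M₁ M₂) (edge hh n) with hC
    have A1 : ∀ k : Fin h₁, k ∉ M₁ →
        C k = C (k + 1) ∧ C (2 * h₁ + h₂ - k) = C (2 * h₁ + h₂ - (k + 1)) := fun k hk =>
      ⟨(PDCode.circle_eq_of_joined ⟨toLex (Sum.inl k),
        Or.inl ⟨(ladderState_inl_eq_A _ _ _).mpr hk, Or.inl ⟨rfl, rfl⟩⟩⟩).symm,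
      PDCode.circle_eq_of_joined ⟨toLex (Sum.inl k),
        Or.inl ⟨(ladderState_inl_eq_A _ _ _).mpr hk, Or.inr ⟨rfl, rfl⟩⟩⟩⟩
    have B1 : ∀ k : Fin h₁, k ∈ M₁ →
        C k = C (2 * h₁ + h₂ - k) ∧ C (k + 1) = C (2 * h₁ + h₂ - (k + 1)) := fun k hk =>
      ⟨PDCode.circle_eq_of_joined ⟨toLex (Sum.inl k),
        Or.inr ⟨(ladderState_inl_eq_B _ _ _).mpr hk, Or.inl ⟨rfl, rfl⟩⟩⟩,
      (PDCode.circle_eq_of_joined ⟨toLex (Sum.inl k),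
        Or.inr ⟨(ladderState_inl_eq_B _ _ _).mpr hk, Or.inr ⟨rfl, rfl⟩⟩⟩).symm⟩
    have A2 : ∀ k : Fin h₂, k ∉ M₂ → C (h₁ + k) = C (h₁ + (k + 1)) ∧
        C (2 * h₁ + 2 * h₂ - k) = C (2 * h₁ + 2 * h₂ - (k + 1)) := fun k hk =>
      ⟨PDCode.circle_eq_of_joined ⟨toLex (Sum.inr k),
        Or.inl ⟨(ladderState_inr_eq_A _ _ _).mpr hk, Or.inl ⟨rfl, rfl⟩⟩⟩,
      (PDCode.circle_eq_of_joined ⟨toLex (Sum.inr k),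
        Or.inl ⟨(ladderState_inr_eq_A _ _ _).mpr hk, Or.inr ⟨rfl, rfl⟩⟩⟩).symm⟩
    have B2 : ∀ k : Fin h₂, k ∈ M₂ → C (h₁ + k) = C (2 * h₁ + 2 * h₂ - k) ∧
        C (h₁ + (k + 1)) = C (2 * h₁ + 2 * h₂ - (k + 1)) := fun k hk =>
      ⟨(PDCode.circle_eq_of_joined ⟨toLex (Sum.inr k),
        Or.inr ⟨(ladderState_inr_eq_B _ _ _).mpr hk, Or.inr ⟨rfl, rfl⟩⟩⟩).symm,
      PDCode.circle_eq_of_joined ⟨toLex (Sum.inr k),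
        Or.inr ⟨(ladderState_inr_eq_B _ _ _).mpr hk, Or.inl ⟨rfl, rfl⟩⟩⟩⟩
    have lr1 : ∀ i ≤ h₁, C i = C (2 * h₁ + h₂ - i) := fun i hi =>
      left_eq_right (p := C) (q := fun i => C (2 * h₁ + h₂ - i)) A1 B1 hM₁ hi
    have lr2 : ∀ i ≤ h₂, C (h₁ + i) = C (2 * h₁ + 2 * h₂ - i) := fun i hi =>
      left_eq_right (p := fun i => C (h₁ + i)) (q := fun i => C (2 * h₁ + 2 * h₂ - i)) A2 B2 hM₂ hi
    have eq1 : ∀ i ≤ h₁, ∀ j ≤ h₁, rank M₁ i = rank M₁ j → C i = C j := fun i hi j hj hij =>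
      eq_of_rank_eq (p := C) (fun k hk => (A1 k hk).1) hi hj hij
    have eq2 : ∀ i ≤ h₂, ∀ j ≤ h₂, rank M₂ i = rank M₂ j → C (h₁ + i) = C (h₁ + j) :=
      fun i hi j hj hij =>
        eq_of_rank_eq (p := fun i => C (h₁ + i)) (fun k hk => (A2 k hk).1) hi hj hij
    -- The top end of `H₁` on the right is the head of the left side of `H₂`; crossing `H₂` leads
    -- back to the edge `0`. Below, `H₁` is crossed in the same way.
    have c0 : C h₁ = C 0 := by
      have := lr2 0 (by omega)
      rw [Nat.sub_zero, Nat.add_zero] at this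
      rw [this]; simp only [hC]; rw [edge_top]
    have c1 : C (h₁ + h₂) = C 0 := by
      have := lr1 h₁ le_rfl
      rw [show 2 * h₁ + h₂ - h₁ = h₁ + h₂ by omega] at this
      rw [← this, c0]
    have z1 : ∀ i ≤ h₁, cyclicRank M₁ i = 0 → C i = C 0 := by
      intro i hi hz
      unfold cyclicRank at hz
      split_ifs at hz with hz'
      · rw [← c0]; exact eq1 i hi h₁ le_rfl (by rw [hz', rank_top])
      · exact eq1 i hi 0 (by omega) (by rw [hz, rank_zero])
    have z2 : ∀ i ≤ h₂, cyclicRank M₂ i = 0 → C (h₁ + i) = C 0 := by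
      intro i hi hz
      unfold cyclicRank at hz
      split_ifs at hz with hz'
      · rw [← c1]; exact eq2 i hi h₂ le_rfl (by rw [hz', rank_top])
      · rw [← c0]; exact eq2 i hi 0 (by omega) (by rw [hz, rank_zero])
    have e1 : ∀ i ≤ h₁, ∀ j ≤ h₁, cyclicRank M₁ i = cyclicRank M₁ j → C i = C j := by
      intro i hi j hj hij
      by_cases hz : cyclicRank M₁ i = 0
      · rw [z1 i hi hz, z1 j hj (hij ▸ hz)]
      · refine eq1 i hi j hj ?_
        unfold cyclicRank at hij hz
        split_ifs at hij hz <;> omega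
    have e2 : ∀ i ≤ h₂, ∀ j ≤ h₂, cyclicRank M₂ i = cyclicRank M₂ j →
        C (h₁ + i) = C (h₁ + j) := by
      intro i hi j hj hij
      by_cases hz : cyclicRank M₂ i = 0
      · rw [z2 i hi hz, z2 j hj (hij ▸ hz)]
      · refine eq2 i hi j hj ?_
        unfold cyclicRank at hij hz
        split_ifs at hij hz <;> omega
    have main : ∀ e : PretzelEdge h₁ h₂,
        (∃ i ≤ h₁, edgeLabel M₁ M₂ e = (cyclicRank M₁ i, 0) ∧
          (pretzel h₁ h₂).circle (ladderState M₁ M₂) e = C i) ∨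
        (∃ i ≤ h₂, edgeLabel M₁ M₂ e = (0, cyclicRank M₂ i) ∧
          (pretzel h₁ h₂).circle (ladderState M₁ M₂) e = C (h₁ + i)) := by
      intro e
      have he := e.isLt
      rw [← edge_val hh e]
      generalize (e : ℕ) = n at he
      by_cases r1 : n ≤ h₁
      · exact Or.inl ⟨n, r1, edgeLabel_one_left hh _ _ r1, rfl⟩
      by_cases r2 : n ≤ h₁ + h₂
      · obtain ⟨i, rfl⟩ : ∃ i, n = h₁ + i := ⟨n - h₁, by omega⟩
        exact Or.inr ⟨i, by omega, edgeLabel_two_left hh _ _ (by omega), rfl⟩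
      by_cases r3 : n ≤ 2 * h₁ + h₂
      · obtain ⟨i, hi, rfl⟩ : ∃ i ≤ h₁, n = 2 * h₁ + h₂ - i :=
          ⟨2 * h₁ + h₂ - n, by omega, by omega⟩
        exact Or.inl ⟨i, hi, edgeLabel_one_right hh _ _ h2 hi, (lr1 i hi).symm⟩
      · obtain ⟨i, hi, rfl⟩ : ∃ i ≤ h₂, n = 2 * h₁ + 2 * h₂ - i :=
          ⟨2 * h₁ + 2 * h₂ - n, by omega, by omega⟩
        exact Or.inr ⟨i, hi, edgeLabel_two_right hh _ _ h1 hi, (lr2 i hi).symm⟩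
    intro hef
    rcases main e with ⟨i, hi, hl, hc⟩ | ⟨i, hi, hl, hc⟩ <;>
      rcases main f with ⟨j, hj, hl', hc'⟩ | ⟨j, hj, hl', hc'⟩ <;>
      rw [hl, hl', Prod.mk.injEq] at hef <;> rw [hc, hc']
    · exact e1 i hi j hj hef.1
    · rw [z1 i hi hef.1, z2 j hj hef.2.symm]
    · rw [z2 i hi hef.2, z1 j hj hef.1.symm]
    · exact e2 i hi j hj hef.2

end state

open PDCode

/-! ### Adding a scar splits a circle; the outer circle -/

variable {M₁ N₁ : Finset (Fin h₁)} {M₂ N₂ : Finset (Fin h₂)}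

theorem add_pos_of_nonempty (hM₁ : M₁.Nonempty) : 0 < h₁ + h₂ :=
  Nat.add_pos_left (Fin.pos hM₁.choose) _

theorem pos_eq_end (e : PretzelEdge h₁ h₂) : (posOne h₁ h₂ e = 0 ∨ posOne h₁ h₂ e = h₁) ∨
    (posTwo h₁ h₂ e = 0 ∨ posTwo h₁ h₂ e = h₂) := by
  unfold posOne posTwo; split_ifs <;> omega

theorem cyclicRank_eq_zero {h : ℕ} (M : Finset (Fin h)) {i : ℕ} (hi : i = 0 ∨ i = h) :
    cyclicRank M i = 0 := by
  rcases hi with rfl | rfl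
  exacts [cyclicRank_zero M, cyclicRank_top M]

theorem erase_nonempty {h : ℕ} {N : Finset (Fin h)} {k : Fin h} (hk : k ∈ N) (hN : 2 ≤ N.card) :
    (N.erase k).Nonempty := by
  rw [← Finset.card_pos]
  have := Finset.card_erase_add_one hk
  omega

/-- By `circle_eq_iff` this is a statement on labels, where `cyclicRank_erase_eq_iff` says that
erasing `k` fuses exactly the places on its two sides. -/
theorem isSplit_inl {k : Fin h₁} (hk : k ∈ N₁) (hN₁ : 2 ≤ N₁.card) (hN₂ : N₂.Nonempty)
    (hh : 0 < h₁ + h₂) :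
    (pretzel h₁ h₂).IsSplit (toLex (Sum.inl k)) (ladderState (N₁.erase k) N₂) (ladderState N₁ N₂)
      (edge hh k) (edge hh (k + 1)) := by
  have hne := erase_nonempty hk hN₁
  have hkl := k.isLt
  have h2 : 0 < h₂ := Fin.pos hN₂.choose
  have hl1 := edgeLabel_one_left hh N₁ N₂ hkl.le
  have hl2 := edgeLabel_one_left hh N₁ N₂ (Nat.succ_le_of_lt hkl)
  refine ⟨by simp [ladderState_inl], by simp [ladderState_inl, hk], ?_, ?_, ?_, ?_⟩
  · intro y hy
    obtain ⟨y, rfl⟩ := toLex.surjective y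
    rcases y with j | j
    · have : j ≠ k := by rintro rfl; exact hy rfl
      simp [ladderState_inl, this]
    · simp [ladderState_inr]
  · intro q
    rw [circle_eq_iff hne hN₂, corner_inl hh, edgeLabel_one_left hh _ _ hkl.le]
    have := cyclicRank_succ_of_notMem (N₁.erase k) (Finset.notMem_erase k N₁)
    fin_cases q <;> simp [edgeLabel_one_left, edgeLabel_one_right, h2, hkl.le,
      Nat.succ_le_of_lt hkl, this]
  · rw [Ne, circle_eq_iff ⟨k, hk⟩ hN₂, hl1, hl2, Prod.mk.injEq]
    exact fun h => cyclicRank_succ_ne N₁ hk hN₁ h.1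
  · intro e f
    simp only [circle_eq_iff hne hN₂, circle_eq_iff ⟨k, hk⟩ hN₂, hl1, hl2]
    simp only [edgeLabel, Prod.mk.injEq, cyclicRank_erase_eq_iff N₁ hk hN₁]
    -- An edge has a nonzero place in at most one ladder, so a place shared with `k` and different
    -- from `0` in `H₁` determines the whole label.
    have hz : ∀ e : PretzelEdge h₁ h₂, cyclicRank N₁ (posOne h₁ h₂ e) = 0 ∨
        cyclicRank N₂ (posTwo h₁ h₂ e) = 0 := fun e =>
      (pos_eq_end e).imp (cyclicRank_eq_zero N₁) (cyclicRank_eq_zero N₂)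
    have he := hz e
    have hf := hz f
    grind

theorem isSplit_inr {k : Fin h₂} (hk : k ∈ N₂) (hN₂ : 2 ≤ N₂.card) (hN₁ : N₁.Nonempty)
    (hh : 0 < h₁ + h₂) :
    (pretzel h₁ h₂).IsSplit (toLex (Sum.inr k)) (ladderState N₁ (N₂.erase k)) (ladderState N₁ N₂)
      (edge hh (h₁ + k)) (edge hh (h₁ + (k + 1))) := by
  have hne := erase_nonempty hk hN₂
  have hkl := k.isLt
  have h1 : 0 < h₁ := Fin.pos hN₁.choose
  have hl1 := edgeLabel_two_left hh N₁ N₂ hkl.le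
  have hl2 := edgeLabel_two_left hh N₁ N₂ (Nat.succ_le_of_lt hkl)
  refine ⟨by simp [ladderState_inr], by simp [ladderState_inr, hk], ?_, ?_, ?_, ?_⟩
  · intro y hy
    obtain ⟨y, rfl⟩ := toLex.surjective y
    rcases y with j | j
    · simp [ladderState_inl]
    · have : j ≠ k := by rintro rfl; exact hy rfl
      simp [ladderState_inr, this]
  · intro q
    rw [circle_eq_iff hN₁ hne, corner_inr hh, edgeLabel_two_left hh _ _ hkl.le]
    have := cyclicRank_succ_of_notMem (N₂.erase k) (Finset.notMem_erase k N₂)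
    fin_cases q <;> simp [edgeLabel_two_left, edgeLabel_two_right, h1, hkl.le,
      Nat.succ_le_of_lt hkl, this]
  · rw [Ne, circle_eq_iff hN₁ ⟨k, hk⟩, hl1, hl2, Prod.mk.injEq]
    exact fun h => cyclicRank_succ_ne N₂ hk hN₂ h.2
  · intro e f
    simp only [circle_eq_iff hN₁ hne, circle_eq_iff hN₁ ⟨k, hk⟩, hl1, hl2]
    simp only [edgeLabel, Prod.mk.injEq, cyclicRank_erase_eq_iff N₂ hk hN₂]
    have hz : ∀ e : PretzelEdge h₁ h₂, cyclicRank N₁ (posOne h₁ h₂ e) = 0 ∨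
        cyclicRank N₂ (posTwo h₁ h₂ e) = 0 := fun e =>
      (pos_eq_end e).imp (cyclicRank_eq_zero N₁) (cyclicRank_eq_zero N₂)
    have he := hz e
    have hf := hz f
    grind

theorem circle_eq_outer_iff (hM₁ : M₁.Nonempty) (hM₂ : M₂.Nonempty) (hh : 0 < h₁ + h₂)
    (e : PretzelEdge h₁ h₂) : (pretzel h₁ h₂).circle (ladderState M₁ M₂) e =
      (pretzel h₁ h₂).circle (ladderState M₁ M₂) (edge hh 0) ↔ edgeLabel M₁ M₂ e = (0, 0) := by
  rw [circle_eq_iff hM₁ hM₂, edgeLabel_one_left hh _ _ (Nat.zero_le _), cyclicRank_zero]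

theorem cyclicRank_isLeast {h : ℕ} {M : Finset (Fin h)} {k : Fin h}
    (hk : IsLeast (M : Set (Fin h)) k) : cyclicRank M k = 0 := by
  have : rank M k = 0 := by
    simp only [rank, Finset.card_eq_zero, Finset.filter_eq_empty_iff, not_lt]
    exact fun j hj => hk.2 hj
  simp [cyclicRank, this]

theorem exists_isLeast {h : ℕ} {M : Finset (Fin h)} (hM : M.Nonempty) :
    ∃ k, IsLeast (M : Set (Fin h)) k := ⟨M.min' hM, M.isLeast_min' hM⟩

theorem isCircleOne_iff (hM₁ : M₁.Nonempty) (hM₂ : M₂.Nonempty) (hh : 0 < h₁ + h₂)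
    (c : (pretzel h₁ h₂).Circle (ladderState M₁ M₂)) : IsCircleOne M₁ M₂ c ↔
      c = (pretzel h₁ h₂).circle (ladderState M₁ M₂) (edge hh 0) := by
  have key : ∀ k, IsLeast (M₁ : Set (Fin h₁)) k →
      (pretzel h₁ h₂).circle (ladderState M₁ M₂) ((pretzel h₁ h₂).corner (toLex (Sum.inl k)) 1) =
      (pretzel h₁ h₂).circle (ladderState M₁ M₂) (edge hh 0) := fun k hk => by
    rw [circle_eq_outer_iff hM₁ hM₂, corner_inl hh]
    exact (edgeLabel_one_left hh M₁ M₂ k.isLt.le).trans (by rw [cyclicRank_isLeast hk])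
  obtain ⟨k, hk⟩ := exists_isLeast hM₁
  exact ⟨fun ⟨j, hj, hc⟩ => hc.trans (key j hj), fun hc => ⟨k, hk, hc.trans (key k hk).symm⟩⟩

theorem isCircleTwo_iff (hM₁ : M₁.Nonempty) (hM₂ : M₂.Nonempty) (hh : 0 < h₁ + h₂)
    (c : (pretzel h₁ h₂).Circle (ladderState M₁ M₂)) : IsCircleTwo M₁ M₂ c ↔
      c = (pretzel h₁ h₂).circle (ladderState M₁ M₂) (edge hh 0) := by
  have key : ∀ k, IsLeast (M₂ : Set (Fin h₂)) k →
      (pretzel h₁ h₂).circle (ladderState M₁ M₂) ((pretzel h₁ h₂).corner (toLex (Sum.inr k)) 0) =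
      (pretzel h₁ h₂).circle (ladderState M₁ M₂) (edge hh 0) := fun k hk => by
    rw [circle_eq_outer_iff hM₁ hM₂, corner_inr hh]
    exact (edgeLabel_two_left hh M₁ M₂ k.isLt.le).trans (by rw [cyclicRank_isLeast hk])
  obtain ⟨k, hk⟩ := exists_isLeast hM₂
  exact ⟨fun ⟨j, hj, hc⟩ => hc.trans (key j hj), fun hc => ⟨k, hk, hc.trans (key k hk).symm⟩⟩

/-- In a state with `B`-labels in both ladders, `C₁⁰` and `C₂⁰` are the same circle. -/
theorem enhancedTwo_eq_enhancedOne (hM₁ : M₁.Nonempty) (hM₂ : M₂.Nonempty) :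
    enhancedTwo M₁ M₂ = enhancedOne M₁ M₂ := by
  classical
  have hh := add_pos_of_nonempty (h₂ := h₂) hM₁
  refine congrArg (Sigma.mk (ladderState M₁ M₂)) (funext fun c => ?_)
  simp only [isCircleOne_iff hM₁ hM₂ hh, isCircleTwo_iff hM₁ hM₂ hh]

theorem nonempty_of_mem_powersetCard {h m : ℕ} {M : Finset (Fin h)}
    (hM : M ∈ (Finset.univ : Finset (Fin h)).powersetCard m) (hm : 1 ≤ m) : M.Nonempty := by
  rw [Finset.mem_powersetCard] at hM
  exact Finset.card_pos.mp (by omega)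

theorem chainTwo_eq_chainOne {m₁ m₂ : ℕ} (hm₁ : 1 ≤ m₁) (hm₂ : 1 ≤ m₂) :
    chainTwo h₁ h₂ m₁ m₂ = chainOne h₁ h₂ m₁ m₂ :=
  Finset.sum_congr rfl fun _ hM₁ => Finset.sum_congr rfl fun _ hM₂ => by
    rw [enhancedTwo_eq_enhancedOne (nonempty_of_mem_powersetCard hM₁ hm₁)
      (nonempty_of_mem_powersetCard hM₂ hm₂)]

theorem enhancedOne_sign (hM₁ : M₁.Nonempty) (hM₂ : M₂.Nonempty) (hh : 0 < h₁ + h₂)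
    (c : (pretzel h₁ h₂).Circle (ladderState M₁ M₂)) : (enhancedOne M₁ M₂).2 c = -1 ↔
      c = (pretzel h₁ h₂).circle (ladderState M₁ M₂) (edge hh 0) := by
  classical
  rw [← isCircleOne_iff hM₁ hM₂]
  change (if IsCircleOne M₁ M₂ c then (-1 : ℤˣ) else 1) = -1 ↔ _
  split_ifs with h <;> simp [h]

/-! ### Incidence numbers and the cycle condition -/

theorem of_adjacentAt_inl {k : Fin h₁} {σ τ}
    (h : (pretzel h₁ h₂).AdjacentAt (toLex (Sum.inl k)) ⟨ladderState M₁ M₂, σ⟩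
      ⟨ladderState N₁ N₂, τ⟩) : k ∈ N₁ ∧ M₁ = N₁.erase k ∧ M₂ = N₂ := by
  obtain ⟨hA, hB, hne⟩ := h.labels
  rw [ladderState_inl_eq_A] at hA
  refine ⟨(ladderState_inl_eq_B N₁ N₂ k).mp hB, ?_, ?_⟩
  · ext j
    by_cases hj : j = k
    · subst hj; simp [hA]
    · rw [Finset.mem_erase, ← ladderState_inl_eq_B N₁ N₂, hne _ (by simpa using hj),
        ladderState_inl_eq_B]
      tauto
  · ext j
    rw [← ladderState_inr_eq_B N₁ N₂, hne _ (by simp), ladderState_inr_eq_B]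

theorem of_adjacentAt_inr {k : Fin h₂} {σ τ}
    (h : (pretzel h₁ h₂).AdjacentAt (toLex (Sum.inr k)) ⟨ladderState M₁ M₂, σ⟩
      ⟨ladderState N₁ N₂, τ⟩) : k ∈ N₂ ∧ M₁ = N₁ ∧ M₂ = N₂.erase k := by
  obtain ⟨hA, hB, hne⟩ := h.labels
  rw [ladderState_inr_eq_A] at hA
  refine ⟨(ladderState_inr_eq_B N₁ N₂ k).mp hB, ?_, ?_⟩
  · ext j
    rw [← ladderState_inl_eq_B N₁ N₂, hne _ (by simp), ladderState_inl_eq_B]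
  · ext j
    by_cases hj : j = k
    · subst hj; simp [hA]
    · rw [Finset.mem_erase, ← ladderState_inr_eq_B N₁ N₂, hne _ (by simpa using hj),
        ladderState_inr_eq_B]
      tauto

theorem ncard_lt_inl (k : Fin h₁) :
    {y | ladderState M₁ M₂ y = Marker.B ∧ y < toLex (Sum.inl k)}.ncard = rank M₁ k := by
  have : {y | ladderState M₁ M₂ y = Marker.B ∧ y < toLex (Sum.inl k)} =
      (fun j : Fin h₁ => (toLex (Sum.inl j) : PretzelCrossing h₁ h₂)) ''
        (M₁.filter fun j : Fin h₁ => (j : ℕ) < k : Finset (Fin h₁)) := by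
    ext y
    obtain ⟨y, rfl⟩ := toLex.surjective y
    rcases y with j | j <;> simp [ladderState_inl, ladderState_inr]
  rw [this, Set.ncard_image_of_injective _ (fun a b h => by simpa using h), Set.ncard_coe_finset]
  rfl

theorem ncard_lt_inr (k : Fin h₂) :
    {y | ladderState M₁ M₂ y = Marker.B ∧ y < toLex (Sum.inr k)}.ncard =
      M₁.card + rank M₂ k := by
  have : {y | ladderState M₁ M₂ y = Marker.B ∧ y < toLex (Sum.inr k)} =
      (fun y => (toLex y : PretzelCrossing h₁ h₂)) ''
        (M₁.disjSum (M₂.filter fun j : Fin h₂ => (j : ℕ) < k) : Finset (Fin h₁ ⊕ Fin h₂)) := by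
    ext y
    obtain ⟨y, rfl⟩ := toLex.surjective y
    rcases y with j | j <;> simp [ladderState_inl, ladderState_inr]
  rw [this, Set.ncard_image_of_injective _ toLex.injective, Set.ncard_coe_finset,
    Finset.card_disjSum]
  rfl

theorem rank_erase_self {h : ℕ} (N : Finset (Fin h)) (k : Fin h) :
    rank (N.erase k) k = rank N k := by
  unfold rank
  rw [Finset.filter_erase, Finset.erase_eq_of_notMem (by simp)]

/-- The sum over the steps of a ladder of the incidence numbers over an enhanced state telescopes. -/
theorem sum_ladder_eq_zero {h : ℕ} (N : Finset (Fin h)) {α : Type*} (o : α) (c : ℕ → α)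
    (P : α → Prop) (Q : Fin h → Prop) [DecidablePred Q]
    (hc : ∀ k : Fin h, k ∉ N → c k = c (k + 1)) (h0 : c 0 = o) (h1 : c h = o)
    (hne : ∀ k : Fin h, k ∈ N → c k ≠ c (k + 1)) (hP : ∀ a b, P a → P b → a ≠ o → a = b)
    (hQ : ∀ k : Fin h, k ∈ N → (Q k ↔ (c k ≠ o ∧ P (c k)) ∨ (c (k + 1) ≠ o ∧ P (c (k + 1))))) :
    ∑ k : Fin h, (if k ∈ N ∧ Q k then (-1 : ℤ) ^ rank N k else 0) = 0 := by
  classical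
  set w : ℕ → ℤ := fun i => if c i ≠ o ∧ P (c i) then (-1) ^ rank N i else 0 with hw
  have hk : ∀ k : Fin h, (if k ∈ N ∧ Q k then (-1 : ℤ) ^ rank N k else 0) = w k - w (k + 1) := by
    intro k
    by_cases hk : k ∈ N
    · have hr := rank_succ N k
      simp only [hk, if_true] at hr
      simp only [hw, hr, hk, true_and, pow_succ, hQ k hk]
      by_cases ha : c k ≠ o ∧ P (c k) <;> by_cases hb : c (k + 1) ≠ o ∧ P (c (k + 1))
      -- At most one circle other than `o` satisfies `P`, so the distinct circles on the two sides
      -- of a scar cannot both qualify.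
      · exact absurd (hP _ _ ha.2 hb.2 ha.1) (hne k hk)
      all_goals simp [ha, hb]
    · have hr := rank_succ N k
      simp only [hk, if_false, add_zero] at hr
      simp [hw, hk, hr, hc k hk]
  rw [Finset.sum_congr rfl fun k _ => hk k,
    Fin.sum_univ_eq_sum_range (fun i => w i - w (i + 1)) h, Finset.sum_range_sub']
  simp [hw, h0, h1]

theorem incidence_eq (S T : (pretzel h₁ h₂).EnhancedState)
    [∀ x, Decidable ((pretzel h₁ h₂).AdjacentAt x S T)] :
    (pretzel h₁ h₂).incidence S T =
    (∑ k : Fin h₁, if (pretzel h₁ h₂).AdjacentAt (toLex (Sum.inl k)) S T then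
      (-1 : ℤ) ^ {y | S.state y = Marker.B ∧ y < toLex (Sum.inl k)}.ncard else 0) +
    ∑ k : Fin h₂, if (pretzel h₁ h₂).AdjacentAt (toLex (Sum.inr k)) S T then
      (-1 : ℤ) ^ {y | S.state y = Marker.B ∧ y < toLex (Sum.inr k)}.ncard else 0 := by
  unfold incidence
  rw [← (toLex (α := Fin h₁ ⊕ Fin h₂)).sum_comp, Fintype.sum_sum_type]
  congr 1 <;> refine Finset.sum_congr rfl fun k _ => ?_ <;> congr

theorem adjacentAt_enhancedOne_inl_iff {k : Fin h₁} (hk : k ∈ N₁) (hN₁ : 2 ≤ N₁.card)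
    (hN₂ : N₂.Nonempty) (hh : 0 < h₁ + h₂)
    (τ : (pretzel h₁ h₂).Circle (ladderState N₁ N₂) → ℤˣ) :
    (pretzel h₁ h₂).AdjacentAt (toLex (Sum.inl k)) (enhancedOne (N₁.erase k) N₂)
      ⟨ladderState N₁ N₂, τ⟩ ↔
    ∃ e, (e = edge hh k ∨ e = edge hh (k + 1)) ∧
      (pretzel h₁ h₂).circle (ladderState N₁ N₂) e ≠
        (pretzel h₁ h₂).circle (ladderState N₁ N₂) (edge hh 0) ∧
      ∀ c, τ c = -1 ↔ c = (pretzel h₁ h₂).circle (ladderState N₁ N₂) (edge hh 0) ∨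
        c = (pretzel h₁ h₂).circle (ladderState N₁ N₂) e :=
  (isSplit_inl hk hN₁ hN₂ hh).adjacentAt_outer_iff (edge hh 0) _
    (enhancedOne_sign (erase_nonempty hk hN₁) hN₂ hh) τ

theorem adjacentAt_enhancedOne_inr_iff {k : Fin h₂} (hk : k ∈ N₂) (hN₂ : 2 ≤ N₂.card)
    (hN₁ : N₁.Nonempty) (hh : 0 < h₁ + h₂)
    (τ : (pretzel h₁ h₂).Circle (ladderState N₁ N₂) → ℤˣ) :
    (pretzel h₁ h₂).AdjacentAt (toLex (Sum.inr k)) (enhancedOne N₁ (N₂.erase k))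
      ⟨ladderState N₁ N₂, τ⟩ ↔
    ∃ e, (e = edge hh (h₁ + k) ∨ e = edge hh (h₁ + (k + 1))) ∧
      (pretzel h₁ h₂).circle (ladderState N₁ N₂) e ≠
        (pretzel h₁ h₂).circle (ladderState N₁ N₂) (edge hh 0) ∧
      ∀ c, τ c = -1 ↔ c = (pretzel h₁ h₂).circle (ladderState N₁ N₂) (edge hh 0) ∨
        c = (pretzel h₁ h₂).circle (ladderState N₁ N₂) e :=
  (isSplit_inr hk hN₂ hN₁ hh).adjacentAt_outer_iff (edge hh 0) _
    (enhancedOne_sign hN₁ (erase_nonempty hk hN₂) hh) τ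

open Classical in
-- Here `P a` says that the negative circles of the target are the outer circle and `a`. This fixes
-- `a` once it is not the outer circle, as the telescoping requires.
theorem sum_inl_eq_zero (hN₁ : 2 ≤ N₁.card) (hN₂ : N₂.Nonempty)
    (τ : (pretzel h₁ h₂).Circle (ladderState N₁ N₂) → ℤˣ) :
    ∑ k : Fin h₁, (if k ∈ N₁ ∧ (pretzel h₁ h₂).AdjacentAt (toLex (Sum.inl k))
      (enhancedOne (N₁.erase k) N₂) ⟨ladderState N₁ N₂, τ⟩ then (-1 : ℤ) ^ rank N₁ k else 0)
      = 0 := by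
  have hne : N₁.Nonempty := Finset.card_pos.mp (by omega)
  have hh := add_pos_of_nonempty (h₂ := h₂) hne
  set C : ℕ → (pretzel h₁ h₂).Circle (ladderState N₁ N₂) :=
    fun i => (pretzel h₁ h₂).circle (ladderState N₁ N₂) (edge hh i) with hC
  have hlab : ∀ i ≤ h₁, edgeLabel N₁ N₂ (edge hh i) = (cyclicRank N₁ i, 0) :=
    fun i hi => edgeLabel_one_left hh N₁ N₂ hi
  refine sum_ladder_eq_zero N₁ (C 0) C (fun a => ∀ c, τ c = -1 ↔ c = C 0 ∨ c = a) _
    ?_ ?_ ?_ ?_ ?_ fun k hk => ?_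
  · intro k hk
    simp only [hC, circle_eq_iff hne hN₂, hlab _ k.isLt.le, hlab _ (Nat.succ_le_of_lt k.isLt),
      cyclicRank_succ_of_notMem N₁ hk]
  · rfl
  · simp only [hC, circle_eq_iff hne hN₂, hlab _ le_rfl, hlab _ (Nat.zero_le _), cyclicRank_top,
      cyclicRank_zero]
  · intro k hk
    simpa only [hC, ne_eq, circle_eq_iff hne hN₂, hlab _ k.isLt.le,
      hlab _ (Nat.succ_le_of_lt k.isLt), Prod.mk.injEq, and_true] using cyclicRank_succ_ne N₁ hk hN₁
  · intro a b ha hb hao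
    exact ((hb a).mp ((ha a).mpr (Or.inr rfl))).resolve_left hao
  · rw [adjacentAt_enhancedOne_inl_iff hk hN₁ hN₂ hh]
    simp only [or_and_right, exists_or, exists_eq_left]
    rfl

open Classical in
theorem sum_inr_eq_zero (hN₂ : 2 ≤ N₂.card) (hN₁ : N₁.Nonempty)
    (τ : (pretzel h₁ h₂).Circle (ladderState N₁ N₂) → ℤˣ) :
    ∑ k : Fin h₂, (if k ∈ N₂ ∧ (pretzel h₁ h₂).AdjacentAt (toLex (Sum.inr k))
      (enhancedOne N₁ (N₂.erase k)) ⟨ladderState N₁ N₂, τ⟩ then (-1 : ℤ) ^ rank N₂ k else 0)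
      = 0 := by
  have hne : N₂.Nonempty := Finset.card_pos.mp (by omega)
  have hh := add_pos_of_nonempty (h₂ := h₂) hN₁
  set C : ℕ → (pretzel h₁ h₂).Circle (ladderState N₁ N₂) :=
    fun i => (pretzel h₁ h₂).circle (ladderState N₁ N₂) (edge hh (h₁ + i)) with hC
  set O := (pretzel h₁ h₂).circle (ladderState N₁ N₂) (edge hh 0) with hO
  have hlab : ∀ i ≤ h₂, edgeLabel N₁ N₂ (edge hh (h₁ + i)) = (0, cyclicRank N₂ i) :=
    fun i hi => edgeLabel_two_left hh N₁ N₂ hi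
  refine sum_ladder_eq_zero N₂ O C (fun a => ∀ c, τ c = -1 ↔ c = O ∨ c = a) _
    ?_ ?_ ?_ ?_ ?_ fun k hk => ?_
  · intro k hk
    simp only [hC, circle_eq_iff hN₁ hne, hlab _ k.isLt.le, hlab _ (Nat.succ_le_of_lt k.isLt),
      cyclicRank_succ_of_notMem N₂ hk]
  · simp only [hC, hO, circle_eq_outer_iff hN₁ hne, hlab _ (Nat.zero_le _), cyclicRank_zero]
  · simp only [hC, hO, circle_eq_outer_iff hN₁ hne, hlab _ le_rfl, cyclicRank_top]
  · intro k hk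
    simpa only [hC, ne_eq, circle_eq_iff hN₁ hne, hlab _ k.isLt.le,
      hlab _ (Nat.succ_le_of_lt k.isLt), Prod.mk.injEq, true_and] using cyclicRank_succ_ne N₂ hk hN₂
  · intro a b ha hb hao
    exact ((hb a).mp ((ha a).mpr (Or.inr rfl))).resolve_left hao
  · rw [adjacentAt_enhancedOne_inr_iff hk hN₂ hN₁ hh]
    simp only [or_and_right, exists_or, exists_eq_left]
    rfl

theorem sum_powersetCard_ite {α β : Type*} [Fintype α] [Fintype β] (m₁ m₂ : ℕ) (A : Finset α)
    (B : Finset β) (F : Finset α → Finset β → ℤ) (hF : ∀ M₁ M₂, F M₁ M₂ ≠ 0 → M₁ = A ∧ M₂ = B) :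
    ∑ M₁ ∈ (Finset.univ : Finset α).powersetCard m₁,
      ∑ M₂ ∈ (Finset.univ : Finset β).powersetCard m₂, F M₁ M₂ =
    if A.card = m₁ ∧ B.card = m₂ then F A B else 0 := by
  rw [← Finset.sum_product']
  have h0 : ∀ M₁ M₂, (M₁, M₂) ≠ (A, B) → F M₁ M₂ = 0 := fun M₁ M₂ hne => by
    by_contra h
    obtain ⟨rfl, rfl⟩ := hF _ _ h
    exact hne rfl
  split_ifs with h
  · rw [Finset.sum_eq_single (A, B)]
    · exact fun p _ hp => h0 p.1 p.2 hp
    · exact fun hn => absurd (by simp [h]) hn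
  · refine Finset.sum_eq_zero fun p hp => h0 p.1 p.2 ?_
    intro hpe
    rw [show p = (A, B) from hpe] at hp
    simp at hp
    exact h hp

open Classical in
-- For a fixed target and change crossing at most one source contributes, the target with that scar
-- removed. Exchanging the sums leaves one alternating sum per ladder, and each vanishes by
-- telescoping. Since `m₁, m₂ ≥ 1`, the ladder receiving the new scar ends with at least two and the
-- other has at least one, so only splits occur.
theorem d_chainOne {m₁ m₂ : ℕ} (hm₁ : 1 ≤ m₁) (hm₂ : 1 ≤ m₂) :
    (pretzel h₁ h₂).d (chainOne h₁ h₂ m₁ m₂) = 0 := by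
  ext T
  obtain ⟨t, τ⟩ := T
  obtain ⟨N₁, N₂, rfl⟩ := exists_eq_ladderState t
  set T : (pretzel h₁ h₂).EnhancedState := ⟨ladderState N₁ N₂, τ⟩ with hT
  have hsum : (pretzel h₁ h₂).d (chainOne h₁ h₂ m₁ m₂) T =
      ∑ M₁ ∈ (Finset.univ : Finset (Fin h₁)).powersetCard m₁,
        ∑ M₂ ∈ (Finset.univ : Finset (Fin h₂)).powersetCard m₂,
          (pretzel h₁ h₂).incidence (enhancedOne M₁ M₂) T := by
    simp only [chainOne, map_sum, Finsupp.finsetSum_apply, d_single_apply, one_mul]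
  rw [hsum]
  simp only [incidence_eq, Finset.sum_add_distrib]
  have hL : ∀ k : Fin h₁, ∑ M₁ ∈ (Finset.univ : Finset (Fin h₁)).powersetCard m₁,
        ∑ M₂ ∈ (Finset.univ : Finset (Fin h₂)).powersetCard m₂,
      (if (pretzel h₁ h₂).AdjacentAt (toLex (Sum.inl k)) (enhancedOne M₁ M₂) T then
      (-1 : ℤ) ^ {y | (enhancedOne M₁ M₂).state y = Marker.B ∧ y < toLex (Sum.inl k)}.ncard else 0)
      = if N₁.card = m₁ + 1 ∧ N₂.card = m₂ then (if k ∈ N₁ ∧ (pretzel h₁ h₂).AdjacentAt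
        (toLex (Sum.inl k)) (enhancedOne (N₁.erase k) N₂) T then (-1 : ℤ) ^ rank N₁ k else 0)
        else 0 := by
    intro k
    rw [sum_powersetCard_ite m₁ m₂ (N₁.erase k) N₂]
    · change (if _ then (if _ then
        (-1 : ℤ) ^ {y | ladderState (N₁.erase k) N₂ y = Marker.B ∧ y < toLex (Sum.inl k)}.ncard
          else 0) else 0) = _
      -- The sign counts scars of the source before `k`; removing `k` itself does not affect that
      -- count, so it can be read in the target.
      rw [ncard_lt_inl, rank_erase_self]
      by_cases hk : k ∈ N₁
      · have := Finset.card_erase_add_one hk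
        simp only [hk, true_and, ← this, Nat.add_right_cancel_iff]
      · have hn : ¬ (pretzel h₁ h₂).AdjacentAt (toLex (Sum.inl k)) (enhancedOne (N₁.erase k) N₂) T :=
          fun h => hk (of_adjacentAt_inl h).1
        simp only [hk, hn, false_and, if_false, ite_self]
    · intro M₁ M₂ h
      have h' : (pretzel h₁ h₂).AdjacentAt (toLex (Sum.inl k)) (enhancedOne M₁ M₂) T := by
        by_contra hn; exact h (if_neg hn)
      exact (of_adjacentAt_inl h').2
  have hR : ∀ k : Fin h₂, ∑ M₁ ∈ (Finset.univ : Finset (Fin h₁)).powersetCard m₁,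
        ∑ M₂ ∈ (Finset.univ : Finset (Fin h₂)).powersetCard m₂,
      (if (pretzel h₁ h₂).AdjacentAt (toLex (Sum.inr k)) (enhancedOne M₁ M₂) T then
      (-1 : ℤ) ^ {y | (enhancedOne M₁ M₂).state y = Marker.B ∧ y < toLex (Sum.inr k)}.ncard else 0)
      = if N₁.card = m₁ ∧ N₂.card = m₂ + 1 then (-1) ^ N₁.card * (if k ∈ N₂ ∧
        (pretzel h₁ h₂).AdjacentAt (toLex (Sum.inr k)) (enhancedOne N₁ (N₂.erase k)) T then
          (-1 : ℤ) ^ rank N₂ k else 0) else 0 := by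
    intro k
    rw [sum_powersetCard_ite m₁ m₂ N₁ (N₂.erase k)]
    · change (if _ then (if _ then
        (-1 : ℤ) ^ {y | ladderState N₁ (N₂.erase k) y = Marker.B ∧ y < toLex (Sum.inr k)}.ncard
          else 0) else 0) = _
      rw [ncard_lt_inr, rank_erase_self, mul_ite, ← pow_add, mul_zero]
      by_cases hk : k ∈ N₂
      · have := Finset.card_erase_add_one hk
        simp only [hk, true_and, ← this, Nat.add_right_cancel_iff]
      · have hn : ¬ (pretzel h₁ h₂).AdjacentAt (toLex (Sum.inr k)) (enhancedOne N₁ (N₂.erase k)) T :=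
          fun h => hk (of_adjacentAt_inr h).1
        simp only [hk, hn, false_and, if_false, ite_self]
    · intro M₁ M₂ h
      have h' : (pretzel h₁ h₂).AdjacentAt (toLex (Sum.inr k)) (enhancedOne M₁ M₂) T := by
        by_contra hn; exact h (if_neg hn)
      exact (of_adjacentAt_inr h').2
  have swap : ∀ {ι : Type} [Fintype ι] (F : Finset (Fin h₁) → Finset (Fin h₂) → ι → ℤ),
      ∑ M₁ ∈ (Finset.univ : Finset (Fin h₁)).powersetCard m₁,
        ∑ M₂ ∈ (Finset.univ : Finset (Fin h₂)).powersetCard m₂, ∑ k, F M₁ M₂ k =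
      ∑ k, ∑ M₁ ∈ (Finset.univ : Finset (Fin h₁)).powersetCard m₁,
        ∑ M₂ ∈ (Finset.univ : Finset (Fin h₂)).powersetCard m₂, F M₁ M₂ k := by
    intro ι _ F
    exact (Finset.sum_congr rfl fun _ _ => Finset.sum_comm).trans Finset.sum_comm
  rw [swap, swap, Finset.sum_congr rfl fun k _ => hL k, Finset.sum_congr rfl fun k _ => hR k]
  have z1 : (∑ k : Fin h₁, if N₁.card = m₁ + 1 ∧ N₂.card = m₂ then (if k ∈ N₁ ∧
      (pretzel h₁ h₂).AdjacentAt (toLex (Sum.inl k)) (enhancedOne (N₁.erase k) N₂) T then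
        (-1 : ℤ) ^ rank N₁ k else 0) else 0) = 0 := by
    by_cases h : N₁.card = m₁ + 1 ∧ N₂.card = m₂
    · simp only [h, and_self, if_true]
      exact sum_inl_eq_zero (by omega) (Finset.card_pos.mp (by omega)) τ
    · simp only [h, if_false, Finset.sum_const_zero]
  have z2 : (∑ k : Fin h₂, if N₁.card = m₁ ∧ N₂.card = m₂ + 1 then (-1) ^ N₁.card * (if k ∈ N₂ ∧
      (pretzel h₁ h₂).AdjacentAt (toLex (Sum.inr k)) (enhancedOne N₁ (N₂.erase k)) T then
        (-1 : ℤ) ^ rank N₂ k else 0) else 0) = 0 := by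
    by_cases h : N₁.card = m₁ ∧ N₂.card = m₂ + 1
    · simp only [h, and_self, if_true]
      rw [← Finset.mul_sum, sum_inr_eq_zero (by omega) (Finset.card_pos.mp (by omega)) τ, mul_zero]
    · simp only [h, if_false, Finset.sum_const_zero]
  rw [z1, z2]
  rfl

/-! ### The parity invariant -/

/-- The enhanced state of underlying state `s(N₁,N₂;)` where only the circle `c` has sign `-`. -/
def singleMinus (c : (pretzel h₁ h₂).Circle (ladderState N₁ N₂)) : (pretzel h₁ h₂).EnhancedState :=
  open Classical in ⟨ladderState N₁ N₂, fun c' => if c' = c then -1 else 1⟩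

variable (N₁ N₂) in
/-- The sum modulo `2` of the coefficients of the enhanced states of underlying state `s(N₁,N₂;)`
with exactly one sign `-`. -/
def minusCount : (pretzel h₁ h₂).Chain →+ ZMod 2 :=
  ∑ c : (pretzel h₁ h₂).Circle (ladderState N₁ N₂),
    (Int.castAddHom (ZMod 2)).comp (Finsupp.applyAddHom (singleMinus c))

theorem minusCount_apply (v : (pretzel h₁ h₂).Chain) : minusCount N₁ N₂ v =
    ∑ c : (pretzel h₁ h₂).Circle (ladderState N₁ N₂), ((v (singleMinus c) : ℤ) : ZMod 2) := by
  simp [minusCount]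

/-- If `x` splits a circle, then an even number of the enhanced states with exactly one sign `-` are
adjacent to a given one with change crossing `x`. -/
theorem sum_adjacentAt_singleMinus {X E : Type} [Finite X] [Finite E] {D : PDCode X E} {x : X}
    {s s' : State X} {a b : E} (h : D.IsSplit x s s' a b) (σ : D.Circle s → ℤˣ) (n : ZMod 2)
    [DecidableEq (D.Circle s')]
    [∀ c : D.Circle s', Decidable
      (D.AdjacentAt x ⟨s, σ⟩ ⟨s', fun c' => if c' = c then -1 else 1⟩)] :
    ∑ c : D.Circle s', (if D.AdjacentAt x ⟨s, σ⟩ ⟨s', fun c' => if c' = c then -1 else 1⟩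
      then n else 0) = 0 := by
  classical
  have key := h.adjacentAt_single_iff σ
  by_cases hσ : ∀ c, σ c = 1
  · have : ∀ c : D.Circle s', (if D.AdjacentAt x ⟨s, σ⟩ ⟨s', fun c' => if c' = c then -1 else 1⟩
      then n else 0) = if c ∈ ({D.circle s' a, D.circle s' b} : Finset (D.Circle s'))
        then n else 0 := by
      intro c
      refine if_congr ?_ rfl rfl
      rw [Finset.mem_insert, Finset.mem_singleton]
      exact (key c).trans (and_iff_right hσ)
    rw [Finset.sum_congr rfl fun c _ => this c, Finset.sum_ite_mem, Finset.univ_inter,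
      Finset.sum_pair h.ne, CharTwo.add_self_eq_zero]
  · refine Finset.sum_eq_zero fun c _ => if_neg fun hc => hσ ((key c).mp hc).1

/-- Two scars in each ladder guarantee that every relabelling ending at this Kauffman state is a
split; each split contributes its incidence number twice or not at all. -/
theorem minusCount_d (hN₁ : 2 ≤ N₁.card) (hN₂ : 2 ≤ N₂.card) (v : (pretzel h₁ h₂).Chain) :
    minusCount N₁ N₂ ((pretzel h₁ h₂).d v) = 0 := by
  classical
  have hne₁ : N₁.Nonempty := Finset.card_pos.mp (by omega)
  have hne₂ : N₂.Nonempty := Finset.card_pos.mp (by omega)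
  have hh := add_pos_of_nonempty (h₂ := h₂) hne₁
  induction v using Finsupp.induction_linear with
  | zero => simp
  | add v w hv hw => rw [map_add, map_add, hv, hw, add_zero]
  | single S n =>
    rw [minusCount_apply]
    simp only [d_single_apply, incidence_eq, Int.cast_mul, Int.cast_add, Int.cast_sum,
      Int.cast_ite, Int.cast_zero]
    -- Fix the change crossing first, so that the inner sum runs over the position of the single
    -- minus.
    rw [← Finset.mul_sum, Finset.sum_add_distrib, Finset.sum_comm,
      Finset.sum_comm (t := (Finset.univ : Finset (Fin h₂)))]
    rw [Finset.sum_eq_zero, Finset.sum_eq_zero, add_zero, mul_zero] <;>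
      obtain ⟨s, σ⟩ := S <;> obtain ⟨M₁, M₂, rfl⟩ := exists_eq_ladderState s
    · intro k _
      by_cases h : k ∈ N₂ ∧ M₁ = N₁ ∧ M₂ = N₂.erase k
      · obtain ⟨hk, rfl, rfl⟩ := h
        exact sum_adjacentAt_singleMinus (isSplit_inr hk hN₂ hne₁ hh) σ _
      · exact Finset.sum_eq_zero fun c _ => if_neg fun hc => h (of_adjacentAt_inr hc)
    · intro k _
      by_cases h : k ∈ N₁ ∧ M₁ = N₁.erase k ∧ M₂ = N₂
      · obtain ⟨hk, rfl, rfl⟩ := h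
        exact sum_adjacentAt_singleMinus (isSplit_inl hk hN₁ hne₂ hh) σ _
      · exact Finset.sum_eq_zero fun c _ => if_neg fun hc => h (of_adjacentAt_inl hc)

theorem enhancedOne_eq_singleMinus_iff (hN₁ : N₁.Nonempty) (hN₂ : N₂.Nonempty) (hh : 0 < h₁ + h₂)
    (c : (pretzel h₁ h₂).Circle (ladderState N₁ N₂)) : enhancedOne M₁ M₂ = singleMinus c ↔
      (M₁ = N₁ ∧ M₂ = N₂) ∧ c = (pretzel h₁ h₂).circle (ladderState N₁ N₂) (edge hh 0) := by
  constructor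
  · intro h
    have h1 : ladderState M₁ M₂ = ladderState N₁ N₂ := congrArg EnhancedState.state h
    obtain ⟨rfl, rfl⟩ := ladderState_inj.mp h1
    refine ⟨⟨rfl, rfl⟩, ?_⟩
    rw [← enhancedOne_sign hN₁ hN₂ hh]
    unfold enhancedOne singleMinus at h
    injection h with _ h2
    exact (congrFun h2 c).trans (if_pos rfl)
  · rintro ⟨⟨rfl, rfl⟩, rfl⟩
    classical
    refine congrArg (Sigma.mk (ladderState M₁ M₂)) (funext fun c => ?_)
    simp only [isCircleOne_iff hN₁ hN₂ hh]

/-- Among the single-minus enhancements of `s(N₁,N₂;)` only the one with negative outer circle can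
occur in the chain, and it occurs at most once. -/
theorem minusCount_chainOne (hN₁ : N₁.Nonempty) (hN₂ : N₂.Nonempty) (m₁ m₂ : ℕ) :
    minusCount N₁ N₂ (chainOne h₁ h₂ m₁ m₂) = if N₁.card = m₁ ∧ N₂.card = m₂ then 1 else 0 := by
  classical
  have hh := add_pos_of_nonempty (h₂ := h₂) hN₁
  rw [minusCount_apply]
  have : ∀ c : (pretzel h₁ h₂).Circle (ladderState N₁ N₂),
      chainOne h₁ h₂ m₁ m₂ (singleMinus c) =
      if c = (pretzel h₁ h₂).circle (ladderState N₁ N₂) (edge hh 0) then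
        (if N₁.card = m₁ ∧ N₂.card = m₂ then 1 else 0) else 0 := by
    intro c
    simp only [chainOne, Finsupp.finsetSum_apply, Finsupp.single_apply,
      enhancedOne_eq_singleMinus_iff hN₁ hN₂ hh]
    rw [sum_powersetCard_ite m₁ m₂ N₁ N₂]
    · by_cases hc : c = (pretzel h₁ h₂).circle (ladderState N₁ N₂) (edge hh 0) <;> simp [hc]
    · intro M₁ M₂ h
      by_contra hn
      exact h (if_neg fun h' => hn h'.1)
  simp only [this]
  rw [← Int.cast_sum, Finset.sum_ite_eq' Finset.univ, if_pos (Finset.mem_univ _)]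
  split_ifs <;> simp

/-! ### Separating the homology classes -/

theorem homologyClass_ne {V W : (pretzel h₁ h₂).Chain} (hV : (pretzel h₁ h₂).d V = 0)
    (hW : (pretzel h₁ h₂).d W = 0) (hN₁ : 2 ≤ N₁.card) (hN₂ : 2 ≤ N₂.card)
    (h : minusCount N₁ N₂ V ≠ minusCount N₁ N₂ W) :
    (pretzel h₁ h₂).homologyClass V hV ≠ (pretzel h₁ h₂).homologyClass W hW := by
  intro heq
  obtain ⟨u, hu⟩ := (Submodule.Quotient.eq _).mp heq
  apply h
  rw [← sub_eq_zero, ← map_sub, ← minusCount_d hN₁ hN₂ u, hu]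
  rfl

theorem d_V {μ₁ μ₂ : ℕ} (hμ₁ : 2 ≤ μ₁) (hμ₂ : 2 ≤ μ₂) :
    (pretzel h₁ h₂).d (V h₁ h₂ μ₁ μ₂) = 0 := by
  unfold V
  rw [chainTwo_eq_chainOne (by omega) (by omega), map_add]
  split_ifs <;> simp [d_chainOne (show 1 ≤ μ₁ + 1 by omega) (show 1 ≤ μ₂ by omega),
    d_chainOne (show 1 ≤ μ₁ by omega) (show 1 ≤ μ₂ + 1 by omega)]

/-- The two possible terms of `V` have different numbers of scars in the ladders, so a Kauffman
state occurring in one does not see the other and no cancellation is possible. -/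
theorem exists_minusCount_V {μ₁ μ₂ : ℕ} (hμ₁ : 2 ≤ μ₁) (hμ₁' : μ₁ ≤ h₁) (hμ₂ : 2 ≤ μ₂)
    (hμ₂' : μ₂ ≤ h₂) (hμ : (Even μ₁ ∧ μ₁ < h₁) ∨ (Even μ₂ ∧ μ₂ < h₂)) :
    ∃ (N₁ : Finset (Fin h₁)) (N₂ : Finset (Fin h₂)), 2 ≤ N₁.card ∧ 2 ≤ N₂.card ∧
      minusCount N₁ N₂ (V h₁ h₂ μ₁ μ₂) ≠ 0 := by
  have hex : ∀ {h m : ℕ}, m ≤ h → ∃ N : Finset (Fin h), N.card = m := fun {h m} hm => by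
    obtain ⟨N, -, hN⟩ := Finset.exists_subset_card_eq (s := (Finset.univ : Finset (Fin h)))
      (n := m) (by simpa using hm)
    exact ⟨N, hN⟩
  have hV : ∀ {N₁ : Finset (Fin h₁)} {N₂ : Finset (Fin h₂)}, N₁.Nonempty → N₂.Nonempty →
      minusCount N₁ N₂ (V h₁ h₂ μ₁ μ₂) =
      (if Even μ₁ ∧ μ₁ < h₁ then (if N₁.card = μ₁ + 1 ∧ N₂.card = μ₂ then 1 else 0) else 0) +
      (if Even μ₂ ∧ μ₂ < h₂ then
        (-1 : ℤ) ^ μ₁ • (if N₁.card = μ₁ ∧ N₂.card = μ₂ + 1 then 1 else 0) else 0) := by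
    intro N₁ N₂ hN₁ hN₂
    unfold V
    rw [chainTwo_eq_chainOne (by omega) (by omega), map_add, apply_ite (minusCount N₁ N₂),
      apply_ite (minusCount N₁ N₂), map_zsmul, minusCount_chainOne hN₁ hN₂,
      minusCount_chainOne hN₁ hN₂, map_zero]
  rcases hμ with hμ | hμ
  · obtain ⟨N₁, hN₁⟩ := hex (Nat.succ_le_of_lt hμ.2)
    obtain ⟨N₂, hN₂⟩ := hex hμ₂'
    refine ⟨N₁, N₂, by omega, by omega, ?_⟩
    rw [hV (Finset.card_pos.mp (by omega)) (Finset.card_pos.mp (by omega))]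
    simp [hμ, hN₁, hN₂]
  · obtain ⟨N₁, hN₁⟩ := hex hμ₁'
    obtain ⟨N₂, hN₂⟩ := hex (Nat.succ_le_of_lt hμ.2)
    refine ⟨N₁, N₂, by omega, by omega, ?_⟩
    rw [hV (Finset.card_pos.mp (by omega)) (Finset.card_pos.mp (by omega))]
    -- The sign of the second term is irrelevant modulo `2`.
    rcases neg_one_pow_eq_or ℤ μ₁ with h | h <;> simp [hμ, hN₁, hN₂, h]

end Khovanov

end

theorem proposition7p3 (h₁ h₂ μ₁ μ₂ : ℕ)
    (hμ₁ : 2 ≤ μ₁) (hμ₁' : μ₁ ≤ h₁) (hμ₂ : 2 ≤ μ₂) (hμ₂' : μ₂ ≤ h₂)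
    (hμ : (Even μ₁ ∧ μ₁ < h₁) ∨ (Even μ₂ ∧ μ₂ < h₂)) :
    ∃ hV : (Khovanov.pretzel h₁ h₂).d (Khovanov.V h₁ h₂ μ₁ μ₂) = 0,
      (∀ μ : ℕ, Odd μ → μ < h₁ →
        ∃ hL : (Khovanov.pretzel h₁ h₂).d (Khovanov.VLeft h₁ h₂ μ) = 0,
          (Khovanov.pretzel h₁ h₂).homologyClass (Khovanov.V h₁ h₂ μ₁ μ₂) hV ≠
            (Khovanov.pretzel h₁ h₂).homologyClass (Khovanov.VLeft h₁ h₂ μ) hL) ∧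
      (∀ μ : ℕ, Odd μ → μ < h₂ →
        ∃ hR : (Khovanov.pretzel h₁ h₂).d (Khovanov.VRight h₁ h₂ μ) = 0,
          (Khovanov.pretzel h₁ h₂).homologyClass (Khovanov.V h₁ h₂ μ₁ μ₂) hV ≠
            (Khovanov.pretzel h₁ h₂).homologyClass (Khovanov.VRight h₁ h₂ μ) hR) := by
  obtain ⟨N₁, N₂, hN₁, hN₂, hV⟩ := Khovanov.exists_minusCount_V hμ₁ hμ₁' hμ₂ hμ₂' hμ
  have hne₁ : N₁.Nonempty := Finset.card_pos.mp (by omega)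
  have hne₂ : N₂.Nonempty := Finset.card_pos.mp (by omega)
  refine ⟨Khovanov.d_V hμ₁ hμ₂, fun μ hodd _ => ?_, fun μ hodd _ => ?_⟩
  · refine ⟨?_, Khovanov.homologyClass_ne _ _ hN₁ hN₂ ?_⟩
    · rw [Khovanov.VLeft, map_zsmul, Khovanov.d_chainOne hodd.pos le_rfl, smul_zero]
    -- `V(μ,0)` has one scar in `H₂`, while `N₂` has at least two steps.
    · rw [Khovanov.VLeft, map_zsmul, Khovanov.minusCount_chainOne hne₁ hne₂, if_neg (by omega),
        smul_zero]
      exact hV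
  · refine ⟨?_, Khovanov.homologyClass_ne _ _ hN₁ hN₂ ?_⟩
    · rw [Khovanov.VRight, Khovanov.chainTwo_eq_chainOne le_rfl hodd.pos,
        Khovanov.d_chainOne le_rfl hodd.pos]
    -- Symmetrically, `V(0,μ)` has one scar in `H₁`, while `N₁` has at least two steps.
    · rw [Khovanov.VRight, Khovanov.chainTwo_eq_chainOne le_rfl hodd.pos,
        Khovanov.minusCount_chainOne hne₁ hne₂, if_neg (by omega)]
      exact hV
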